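/- Let $n\ge 0$, $T>0$, $I=[0,T]$, $I_0=(0,T)$, $\Omega=\mathbb R^n/\mathbb Z^n$; functions on $\Omega$ are identified with $\mathbb Z^n$-periodic functions on $\mathbb R^n$. Let $P\in C^1(\Omega\times I)$. For $x,y\in\mathbb R^n$ and $t_1<t_2$ in $I$ let $$J_P(x,y,t_1,t_2)=\inf_{\gamma}\int_{t_1}^{t_2}\Big[\tfrac12|\dot\gamma(t)|^2+P(\gamma(t),t)\Big]dt ,$$ the infimum being over all $C^1$ curves $\gamma:[t_1,t_2]\to\mathbb R^n$ with $\gamma(t_1)=x$, $\gamma(t_2)=y$. A function $\phi:\Omega\times I\to\mathbb R$ is a forward solution of the Hamilton--Jacobi equation $$\phi_t+\tfrac12|\nabla_x\phi|^2=P \qquad (\mathrm{HJ})$$ if $\phi(x,t_1)=\inf_{y\in\mathbb R^n}[J_P(y,x,t_0,t_1)+\phi(y,t_0)]$ for all $x$ and all $t_0<t_1$ in $I$, and a backward solution if $\phi(x,t_0)=\sup_{y\in\mathbb R^n}[-J_P(x,y,t_0,t_1)+\phi(y,t_1)]$ for all $x$ and all $t_0<t_1$ in $I$. Let $\{\overline\phi,\underline\phi\}$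 be a reversible pair, i.e. $\overline\phi$ is a forward solution, $\underline\phi$ is a backward solution, and $\overline\phi(\cdot,0)=\underline\phi(\cdot,0)$, $\overline\phi(\cdot,T)=\underline\phi(\cdot,T)$ on $\Omega$. Put $$K_0=\{(x,t)\in\Omega\times I_0:\ \overline\phi(x,t)=\underline\phi(x,t)\}.$$ Then $\overline\phi$ and $\underline\phi$ are differentiable (jointly in $(x,t)$) at every point of $K_0$, their gradients coincide there, $(\nabla_x\overline\phi,\overline\phi_t)=(\nabla_x\underline\phi,\underline\phi_t)$ on $K_0$, and both functions satisfy (HJ) at every point of $K_0$. If, in addition, there is a positive locally integrable (for instance, a continuous) function $C$ on $I_0$ such that $x\mapsto P(x,t)-C(t)|x|^2$ is concave on $\mathbb R^n$ for every $t\in I_0$, then the common full gradient $(\nabla_x\phi,\phi_t)$, and in particular $\nabla_x\phi$, is locally Lipschitz on $K_0$ as a function of $(x,t)$. -/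

import Mathlib

open MeasureTheory Set

noncomputable section

namespace HamiltonJacobi

/-- The covering space `ℝⁿ` of the flat torus `Ω = ℝⁿ / ℤⁿ`, with the Euclidean norm. -/
abbrev Space (n : ℕ) : Type := EuclideanSpace ℝ (Fin n)

/-- The vector of `ℝⁿ` with the integer coordinates `z`. -/
def latticeVector {n : ℕ} (z : Fin n → ℤ) : Space n :=
  WithLp.toLp 2 (fun i => (z i : ℝ))

/-- `f` is a function on `Ω × [0,T]`, i.e. `f(·,t)` is `ℤⁿ`-periodic for every `t ∈ [0,T]`.
Values of `f` at times outside `[0,T]` play no role. -/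
def IsTorusFunction {n : ℕ} (T : ℝ) (f : Space n × ℝ → ℝ) : Prop :=
  ∀ (z : Fin n → ℤ) (x : Space n), ∀ t ∈ Icc (0 : ℝ) T, f (x + latticeVector z, t) = f (x, t)

/-- The action `∫_{t₁}^{t₂} (|γ'|²/2 + P(γ(t),t)) dt` of the orbit `γ`. -/
def orbitAction {n : ℕ} (P : Space n × ℝ → ℝ) (t₁ t₂ : ℝ) (γ : ℝ → Space n) : ℝ :=
  ∫ t in t₁..t₂, (‖deriv γ t‖ ^ 2 / 2 + P (γ t, t))

/-- `J_P(x,y,t₁,t₂)`: the infimum of the action over the `C¹` orbits in `ℝⁿ` from `x` at time `t₁`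
to `y` at time `t₂`. (Every `C¹` orbit on `[t₁,t₂]` is the restriction of a `C¹` orbit on `ℝ`,
and only its values on `[t₁,t₂]` enter the action.) -/
def minimalAction {n : ℕ} (P : Space n × ℝ → ℝ) (x y : Space n) (t₁ t₂ : ℝ) : ℝ :=
  sInf {A : ℝ | ∃ γ : ℝ → Space n,
    ContDiff ℝ 1 γ ∧ γ t₁ = x ∧ γ t₂ = y ∧ A = orbitAction P t₁ t₂ γ}

/-- Forward solutions of `φ_t + |∇ₓφ|²/2 = P` on `Ω × [0,T]`:
`φ(x,t₁) = inf_y [J_P(y,x,t₀,t₁) + φ(y,t₀)]` for all `t₀ < t₁` in `[0,T]`. -/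
structure IsForwardSolution {n : ℕ} (T : ℝ) (P φ : Space n × ℝ → ℝ) : Prop where
  periodic : IsTorusFunction T φ
  isGLB : ∀ (x : Space n), ∀ t₀ ∈ Icc (0 : ℝ) T, ∀ t₁ ∈ Icc (0 : ℝ) T, t₀ < t₁ →
    IsGLB (range fun y : Space n => minimalAction P y x t₀ t₁ + φ (y, t₀)) (φ (x, t₁))

/-- Backward solutions of `φ_t + |∇ₓφ|²/2 = P` on `Ω × [0,T]`:
`φ(x,t₀) = sup_y [-J_P(x,y,t₀,t₁) + φ(y,t₁)]` for all `t₀ < t₁` in `[0,T]`. -/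
structure IsBackwardSolution {n : ℕ} (T : ℝ) (P φ : Space n × ℝ → ℝ) : Prop where
  periodic : IsTorusFunction T φ
  isLUB : ∀ (x : Space n), ∀ t₀ ∈ Icc (0 : ℝ) T, ∀ t₁ ∈ Icc (0 : ℝ) T, t₀ < t₁ →
    IsLUB (range fun y : Space n => -minimalAction P x y t₀ t₁ + φ (y, t₁)) (φ (x, t₀))

/-- A reversible pair: a forward solution `φf` and a backward solution `φb` which agree at
`t = 0` and at `t = T`. -/
structure IsReversiblePair {n : ℕ} (T : ℝ) (P φf φb : Space n × ℝ → ℝ) : Prop where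
  forward : IsForwardSolution T P φf
  backward : IsBackwardSolution T P φb
  initial : ∀ x : Space n, φf (x, 0) = φb (x, 0)
  final : ∀ x : Space n, φf (x, T) = φb (x, T)

/-- The reversibility set `K₀ = {(x,t) ; 0 < t < T, φf(x,t) = φb(x,t)}`. -/
def reversibilitySet {n : ℕ} (T : ℝ) (φf φb : Space n × ℝ → ℝ) : Set (Space n × ℝ) :=
  {p | p.2 ∈ Ioo (0 : ℝ) T ∧ φf p = φb p}

/-- The spatial gradient `∇ₓφ`. -/
def spaceGradient {n : ℕ} (φ : Space n × ℝ → ℝ) (p : Space n × ℝ) : Space n :=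
  gradient (fun x => φ (x, p.2)) p.1

/-- The time derivative `φ_t`. -/
def timeDerivative {n : ℕ} (φ : Space n × ℝ → ℝ) (p : Space n × ℝ) : ℝ :=
  deriv (fun t => φ (p.1, t)) p.2

/-- The full gradient `∇φ = {∇ₓφ, φ_t}`. -/
def fullGradient {n : ℕ} (φ : Space n × ℝ → ℝ) (p : Space n × ℝ) : Space n × ℝ :=
  (spaceGradient φ p, timeDerivative φ p)

/-- The equation `φ_t + |∇ₓφ|²/2 = P` at the point `p`. -/
def SatisfiesHJAt {n : ℕ} (P φ : Space n × ℝ → ℝ) (p : Space n × ℝ) : Prop :=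
  timeDerivative φ p + ‖spaceGradient φ p‖ ^ 2 / 2 = P p

/-- There is a positive, locally integrable function `C` on `(0,T)` such that
`x ↦ P(x,t) - C(t)|x|²` is concave on `ℝⁿ` for every `t ∈ (0,T)`. -/
def IsSemiconcavePressure {n : ℕ} (T : ℝ) (P : Space n × ℝ → ℝ) : Prop :=
  ∃ C : ℝ → ℝ, LocallyIntegrableOn C (Ioo (0 : ℝ) T) volume ∧
    ∀ t ∈ Ioo (0 : ℝ) T, 0 < C t ∧
      ConcaveOn ℝ univ (fun x : Space n => P (x, t) - C t * ‖x‖ ^ 2)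

end HamiltonJacobi

end

/-!
A forward solution is superdifferentiable at every interior point `p`: nearly minimal curves that
end at `p` and last a short time have bounded velocities, the velocity `v` of such a curve is nearly
the spatial slope of the action in its end point, and the time slope is then nearly `P p - |v|²/2`.
Limits of these covectors as the time span shrinks are superdifferentials which satisfy the
equation. Reversing time, a backward solution is subdifferentiable. As the backward solution never
exceeds the forward one, at a point where the two touch the sub- and the superdifferential
coincide, so both functions are differentiable there with the same derivative.

If `P` is semiconcave in space, then so are the minimal action and hence the solutions, up to sign.
At a touching point `p` this yields two-sided quadratic bounds in space, which propagate forward in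
time as bounds on the forward solution with an error of order `|z|²` at `p + z`. If `p + z` is
another touching point, then comparing the upper bound based at `p` with the lower bound based at
`p + z`, at all points `p + z + (w, 0)` with `|w| ≤ |z|`, bounds the difference of the gradients by
a multiple of `|z|`.
-/

noncomputable section

open Filter Topology
open scoped NNReal

namespace HamiltonJacobi

section Superdifferential

variable {X : Type*} [NormedAddCommGroup X] [NormedSpace ℝ X]
  {f g : X → ℝ} {ℓ ℓ' : X →L[ℝ] ℝ} {x₀ : X}

/-- `ℓ` belongs to the Fréchet superdifferential of `f` at `x₀`. The subdifferential of `f` is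
encoded as minus the superdifferential of `-f`. -/
def HasSuperderivAt (f : X → ℝ) (ℓ : X →L[ℝ] ℝ) (x₀ : X) : Prop :=
  ∀ η > 0, ∀ᶠ z in 𝓝 0, f (x₀ + z) ≤ f x₀ + ℓ z + η * ‖z‖

namespace HasSuperderivAt

lemma eq_of_le (hf : HasSuperderivAt f ℓ x₀) (hg : HasSuperderivAt (-g) (-ℓ') x₀)
    (hle : ∀ᶠ z in 𝓝 0, g (x₀ + z) ≤ f (x₀ + z)) (heq : f x₀ = g x₀) : ℓ = ℓ' := by
  have hbound : ∀ η > 0, ∀ᶠ z in 𝓝 (0 : X), (ℓ' - ℓ) z ≤ η * ‖z‖ := fun η hη => by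
    filter_upwards [hf (η / 2) (by linarith), hg (η / 2) (by linarith), hle] with z h₁ h₂ h₃
    simp only [Pi.neg_apply, neg_apply] at h₂
    rw [sub_apply]
    linarith
  have hzero : HasFDerivAt (ℓ' - ℓ) (0 : X →L[ℝ] ℝ) 0 := by
    rw [hasFDerivAt_iff_isLittleO_nhds_zero, Asymptotics.isLittleO_iff]
    intro η hη
    have hneg : Tendsto (fun z : X => -z) (𝓝 0) (𝓝 0) := by
      simpa using (continuous_neg (G := X)).tendsto 0
    filter_upwards [hbound η hη, hneg.eventually (hbound η hη)] with z h₁ h₂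
    rw [map_neg, norm_neg] at h₂
    rw [zero_apply, map_zero, zero_add, sub_zero, sub_zero, Real.norm_eq_abs, abs_le]
    exact ⟨by linarith, h₁⟩
  exact (sub_eq_zero.1 ((ℓ' - ℓ).hasFDerivAt.unique hzero)).symm

lemma hasFDerivAt_of_le (hf : HasSuperderivAt f ℓ x₀) (hg : HasSuperderivAt (-g) (-ℓ) x₀)
    (hle : ∀ᶠ z in 𝓝 0, g (x₀ + z) ≤ f (x₀ + z)) (heq : f x₀ = g x₀) :
    HasFDerivAt f ℓ x₀ ∧ HasFDerivAt g ℓ x₀ := by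
  simp only [hasFDerivAt_iff_isLittleO_nhds_zero, Asymptotics.isLittleO_iff, Real.norm_eq_abs,
    abs_le]
  constructor <;> intro η hη <;> filter_upwards [hf η hη, hg η hη, hle] with z h₁ h₂ h₃ <;>
    simp only [Pi.neg_apply, neg_apply] at h₂ <;>
    constructor <;> linarith

end HasSuperderivAt

lemma exists_forall_le_of_isCompact {S : Set (X →L[ℝ] ℝ)} (hS : IsCompact S) {ρ η : ℝ}
    (h : ∀ ε > 0, ∃ ℓ ∈ S, ∀ z, ‖z‖ ≤ ρ → f (x₀ + z) ≤ f x₀ + ℓ z + η * ‖z‖ + ε) :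
    ∃ ℓ ∈ S, ∀ z, ‖z‖ ≤ ρ → f (x₀ + z) ≤ f x₀ + ℓ z + η * ‖z‖ := by
  choose ℓ hℓS hℓ using fun k : ℕ => h (1 / (k + 1)) Nat.one_div_pos_of_nat
  obtain ⟨ℓ₀, hℓ₀S, κ, hκ, hlim⟩ := hS.tendsto_subseq hℓS
  refine ⟨ℓ₀, hℓ₀S, fun z hz => ?_⟩
  have happly : Tendsto (fun k => ℓ (κ k) z) atTop (𝓝 (ℓ₀ z)) :=
    ((ContinuousLinearMap.apply ℝ ℝ z).continuous.tendsto ℓ₀).comp hlim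
  have hε : Tendsto (fun k => 1 / ((κ k : ℝ) + 1)) atTop (𝓝 0) :=
    tendsto_one_div_add_atTop_nhds_zero_nat.comp hκ.tendsto_atTop
  simpa using ge_of_tendsto' (((happly.const_add (f x₀)).add_const (η * ‖z‖)).add hε)
    fun k => hℓ (κ k) z hz

lemma exists_hasSuperderivAt {S : Set (X →L[ℝ] ℝ)} (hS : IsCompact S)
    (h : ∀ η > 0, ∃ ρ > 0, ∀ ε > 0, ∃ ℓ ∈ S, ∀ z, ‖z‖ ≤ ρ →
      f (x₀ + z) ≤ f x₀ + ℓ z + η * ‖z‖ + ε) :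
    ∃ ℓ ∈ S, HasSuperderivAt f ℓ x₀ := by
  have h' : ∀ η > 0, ∃ ρ > 0, ∃ ℓ ∈ S, ∀ z, ‖z‖ ≤ ρ → f (x₀ + z) ≤ f x₀ + ℓ z + η * ‖z‖ :=
    fun η hη => let ⟨ρ, hρ, hh⟩ := h η hη
      ⟨ρ, hρ, exists_forall_le_of_isCompact hS hh⟩
  choose ρ hρ ℓ hℓS hℓ using fun k : ℕ => h' (1 / (k + 1)) Nat.one_div_pos_of_nat
  obtain ⟨ℓ₀, hℓ₀S, κ, hκ, hlim⟩ := hS.tendsto_subseq hℓS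
  refine ⟨ℓ₀, hℓ₀S, fun η hη => ?_⟩
  have hsmall : ∀ᶠ k in atTop, 1 / ((κ k : ℝ) + 1) < η / 2 :=
    (tendsto_one_div_add_atTop_nhds_zero_nat.comp hκ.tendsto_atTop).eventually_lt_const
      (half_pos hη)
  have hclose : ∀ᶠ k in atTop, ‖ℓ (κ k) - ℓ₀‖ < η / 2 := by
    simpa only [dist_eq_norm, Function.comp_apply] using
      (tendsto_iff_dist_tendsto_zero.1 hlim).eventually_lt_const
      (half_pos hη)
  obtain ⟨k, hk, hk'⟩ := (hsmall.and hclose).exists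
  filter_upwards [Metric.closedBall_mem_nhds (0 : X) (hρ (κ k))] with z hz
  have h₁ := hℓ (κ k) z (by simpa using hz)
  have h₂ : (ℓ (κ k) - ℓ₀) z ≤ η / 2 * ‖z‖ :=
    (le_abs_self _).trans ((ℓ (κ k) - ℓ₀).le_of_opNorm_le hk'.le z)
  have h₃ : 1 / ((κ k : ℝ) + 1) * ‖z‖ ≤ η / 2 * ‖z‖ := by gcongr
  rw [sub_apply] at h₂
  linarith

end Superdifferential

section StrongConcavity

variable {X : Type*} [NormedAddCommGroup X] [NormedSpace ℝ X] {f : X → ℝ} {m : ℝ}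

lemma strongConcaveOn_of_isGLB {ι : Type*} {F : ι → X → ℝ}
    (hF : ∀ i, StrongConcaveOn univ m (F i)) (hf : ∀ x, IsGLB (range fun i => F i x) (f x)) :
    StrongConcaveOn univ m f := by
  refine ⟨convex_univ, fun x _ y _ a b ha hb hab => (hf _).2 ?_⟩
  rintro _ ⟨i, rfl⟩
  refine le_trans ?_ ((hF i).2 (mem_univ x) (mem_univ y) ha hb hab)
  gcongr
  · exact (hf x).1 ⟨i, rfl⟩
  · exact (hf y).1 ⟨i, rfl⟩

lemma le_of_strongConcaveOn_of_hasFDerivAt {ℓ : X →L[ℝ] ℝ} {x₀ : X}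
    (hf : StrongConcaveOn univ m f) (hℓ : HasFDerivAt f ℓ x₀) (ξ : X) :
    f (x₀ + ξ) ≤ f x₀ + ℓ ξ - m / 2 * ‖ξ‖ ^ 2 := by
  have hslope : Tendsto (fun θ : ℝ => θ⁻¹ * (f (x₀ + θ • ξ) - f x₀)) (𝓝[>] 0) (𝓝 (ℓ ξ)) := by
    simpa [HasLineDerivAt] using ((hℓ.hasLineDerivAt ξ).tendsto_slope_zero_right)
  have hcoef : Tendsto (fun θ : ℝ => (1 - θ) * (m / 2 * ‖ξ‖ ^ 2)) (𝓝[>] 0)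
      (𝓝 ((1 - 0) * (m / 2 * ‖ξ‖ ^ 2))) :=
    ((continuous_const.sub continuous_id).mul continuous_const).tendsto' _ _ (by simp)
      |>.mono_left nhdsWithin_le_nhds
  have hchord : ∀ᶠ θ in 𝓝[>] (0 : ℝ),
      f (x₀ + ξ) - f x₀ + (1 - θ) * (m / 2 * ‖ξ‖ ^ 2) ≤ θ⁻¹ * (f (x₀ + θ • ξ) - f x₀) := by
    filter_upwards [Ioo_mem_nhdsGT one_pos] with θ hθ
    have h := hf.2 (mem_univ x₀) (mem_univ (x₀ + ξ)) (sub_nonneg.2 hθ.2.le) hθ.1.le (by ring)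
    rw [show (1 - θ) • x₀ + θ • (x₀ + ξ) = x₀ + θ • ξ by module, sub_add_cancel_left, norm_neg]
      at h
    rw [le_inv_mul_iff₀ hθ.1]
    simp only [smul_eq_mul] at h
    linarith
  have := le_of_tendsto_of_tendsto (tendsto_const_nhds.add hcoef) hslope hchord
  linarith

end StrongConcavity

section Curves

variable {E : Type*}

/-- The curve `γ` run from time `s` on with its time scale multiplied by `c`. -/
def stretch (γ : ℝ → E) (s c : ℝ) (τ : ℝ) : E := γ (s + c⁻¹ * (τ - s))

@[simp] lemma stretch_left (γ : ℝ → E) (s c : ℝ) : stretch γ s c s = γ s := by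
  simp [stretch]

lemma stretch_right (γ : ℝ → E) (s t : ℝ) {c : ℝ} (hc : c ≠ 0) :
    stretch γ s c (s + c * (t - s)) = γ t := by
  simp [stretch, hc]

lemma integral_comp_stretch (F : E × ℝ → ℝ) (γ : ℝ → E) (s t : ℝ) {c : ℝ} (hc : c ≠ 0) :
    ∫ τ in s..s + c * (t - s), F (stretch γ s c τ, τ) =
      c * ∫ τ in s..t, F (γ τ, s + c * (τ - s)) := by
  have hcoord : ∀ τ, c * τ + (s - c * s) = s + c * (τ - s) := fun τ => by ring
  have h := intervalIntegral.smul_integral_comp_mul_add (a := s) (b := t)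
    (fun τ => F (stretch γ s c τ, τ)) c (s - c * s)
  simpa only [hcoord, stretch_right γ s _ hc, sub_self, mul_zero, add_zero, smul_eq_mul]
    using h.symm

variable [NormedAddCommGroup E] [InnerProductSpace ℝ E] {γ : ℝ → E} {s t τ : ℝ}

/-- The kinetic part `∫ |γ'|²/2` of the action of `γ` on `[s, t]`. -/
def kineticAction (s t : ℝ) (γ : ℝ → E) : ℝ := ∫ τ in s..t, ‖deriv γ τ‖ ^ 2 / 2

/-- The average `(γ(t) - γ(s)) / (t - s)` of the velocity of `γ` on `[s, t]`. -/
def meanVelocity (s t : ℝ) (γ : ℝ → E) : E := (t - s)⁻¹ • (γ t - γ s)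

/-- The part of the kinetic action of `γ` which exceeds that of the straight curve with the same
end points; see `kineticAction_eq_add_excessAction`. -/
def excessAction (s t : ℝ) (γ : ℝ → E) : ℝ :=
  ∫ τ in s..t, ‖deriv γ τ - meanVelocity s t γ‖ ^ 2 / 2

lemma excessAction_nonneg (hst : s ≤ t) : 0 ≤ excessAction s t γ :=
  intervalIntegral.integral_nonneg hst fun _ _ => by positivity

lemma smul_meanVelocity (hst : s ≠ t) : (t - s) • meanVelocity s t γ = γ t - γ s :=
  smul_inv_smul₀ (sub_ne_zero.2 hst.symm) _

lemma norm_sub_sq_div_eq (hst : s ≠ t) :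
    ‖γ t - γ s‖ ^ 2 / (2 * (t - s)) = (t - s) * (‖meanVelocity s t γ‖ ^ 2 / 2) := by
  have h0 : t - s ≠ 0 := sub_ne_zero.2 hst.symm
  rw [← smul_meanVelocity hst, norm_smul, mul_pow, Real.norm_eq_abs, sq_abs]
  field_simp

lemma mem_closedBall_of_norm_meanVelocity_le {R : ℝ} (hst : s < t)
    (hR : ‖meanVelocity s t γ‖ ≤ R) :
    (γ s, s) ∈ Metric.closedBall (γ t, t) ((1 + R) * (t - s)) := by
  have h0 : 0 < t - s := sub_pos.2 hst
  have hR0 : 0 ≤ R := (norm_nonneg _).trans hR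
  rw [Metric.mem_closedBall, dist_comm, Prod.dist_eq, dist_eq_norm, Real.dist_eq, abs_of_pos h0,
    ← smul_meanVelocity hst.ne, norm_smul, Real.norm_of_nonneg h0.le]
  exact max_le (by nlinarith) (by nlinarith)

lemma integral_inner_deriv (hγ : ContDiff ℝ 1 γ) (u : E) :
    ∫ τ in s..t, inner ℝ u (deriv γ τ) = inner ℝ u (γ t - γ s) := by
  have : Continuous (deriv γ) := hγ.continuous_deriv le_rfl
  rw [intervalIntegral.integral_eq_sub_of_hasDerivAt (f := fun τ => inner ℝ u (γ τ)),
    inner_sub_right]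
  · intro τ _
    simpa using (hasDerivAt_const τ u).inner ℝ (hγ.differentiable (by norm_num) τ).hasDerivAt
  · exact Continuous.intervalIntegrable (by fun_prop) _ _

lemma kineticAction_add_const (hγ : ContDiff ℝ 1 γ) (v : E) :
    ∫ τ in s..t, ‖deriv γ τ + v‖ ^ 2 / 2 =
      kineticAction s t γ + inner ℝ v (γ t - γ s) + (t - s) * (‖v‖ ^ 2 / 2) := by
  have : Continuous (deriv γ) := hγ.continuous_deriv le_rfl
  have hexpand : ∀ τ, ‖deriv γ τ + v‖ ^ 2 / 2 =
      ‖deriv γ τ‖ ^ 2 / 2 + inner ℝ v (deriv γ τ) + ‖v‖ ^ 2 / 2 := fun τ => by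
    rw [norm_add_sq_real, real_inner_comm v]
    ring
  simp_rw [hexpand]
  rw [intervalIntegral.integral_add (Continuous.intervalIntegrable (by fun_prop) _ _) (by simp),
    intervalIntegral.integral_add (Continuous.intervalIntegrable (by fun_prop) _ _)
      (Continuous.intervalIntegrable (by fun_prop) _ _), integral_inner_deriv hγ,
    intervalIntegral.integral_const, smul_eq_mul, kineticAction]

lemma kineticAction_eq_add_excessAction (hst : s ≠ t) (hγ : ContDiff ℝ 1 γ) :
    kineticAction s t γ = ‖γ t - γ s‖ ^ 2 / (2 * (t - s)) + excessAction s t γ := by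
  have h0 : t - s ≠ 0 := sub_ne_zero.2 hst.symm
  simp only [excessAction, sub_eq_add_neg (deriv γ _)]
  rw [kineticAction_add_const hγ, norm_neg, inner_neg_left, meanVelocity, real_inner_smul_left,
    real_inner_self_eq_norm_sq, norm_smul, mul_pow, Real.norm_eq_abs, sq_abs]
  field_simp
  ring

/-- The curve `γ` sheared so that its end point on `[s, t]` moves by `ξ` and its starting point
stays put. -/
def displace (γ : ℝ → E) (s t : ℝ) (ξ : E) (τ : ℝ) : E := γ τ + ((τ - s) / (t - s)) • ξ

lemma contDiff_displace (hγ : ContDiff ℝ 1 γ) (s t : ℝ) (ξ : E) :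
    ContDiff ℝ 1 (displace γ s t ξ) := by
  unfold displace
  fun_prop

@[simp] lemma displace_left (γ : ℝ → E) (s t : ℝ) (ξ : E) : displace γ s t ξ s = γ s := by
  simp [displace]

lemma displace_right (γ : ℝ → E) (hst : s ≠ t) (ξ : E) : displace γ s t ξ t = γ t + ξ := by
  simp [displace, div_self (sub_ne_zero.2 hst.symm)]

lemma norm_displace_sub_le (γ : ℝ → E) (ξ : E) (hτ : τ ∈ Icc s t) :
    ‖displace γ s t ξ τ - γ τ‖ ≤ ‖ξ‖ := by
  have hs : 0 ≤ τ - s := sub_nonneg.2 hτ.1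
  have ht : τ - s ≤ t - s := sub_le_sub_right hτ.2 s
  rw [displace, add_sub_cancel_left, norm_smul,
    Real.norm_of_nonneg (div_nonneg hs (hs.trans ht))]
  exact mul_le_of_le_one_left (norm_nonneg ξ) (div_le_one_of_le₀ ht (hs.trans ht))

lemma dist_displace_stretch_le (γ : ℝ → E) (hst : s < t) (z : E × ℝ) (hτ : τ ∈ Icc s t) :
    dist (displace γ s t z.1 τ, s + (1 + z.2 / (t - s)) * (τ - s)) (γ τ, τ) ≤ ‖z‖ := by
  have hτs : 0 ≤ τ - s := sub_nonneg.2 hτ.1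
  have hst' : 0 < t - s := sub_pos.2 hst
  rw [Prod.dist_eq, dist_eq_norm, Real.dist_eq, Prod.norm_def]
  refine max_le_max (norm_displace_sub_le γ z.1 hτ) ?_
  rw [show s + (1 + z.2 / (t - s)) * (τ - s) - τ = (τ - s) / (t - s) * z.2 by ring, abs_mul,
    abs_of_nonneg (div_nonneg hτs hst'.le)]
  exact mul_le_of_le_one_left (abs_nonneg _)
    (div_le_one_of_le₀ (sub_le_sub_right hτ.2 s) hst'.le)

lemma kineticAction_displace (hst : s ≠ t) (hγ : ContDiff ℝ 1 γ) (ξ : E) :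
    kineticAction s t (displace γ s t ξ) = kineticAction s t γ +
      inner ℝ (meanVelocity s t γ) ξ + ‖ξ‖ ^ 2 / (2 * (t - s)) := by
  have h0 : t - s ≠ 0 := sub_ne_zero.2 hst.symm
  have hderiv : ∀ τ, deriv (displace γ s t ξ) τ = deriv γ τ + (t - s)⁻¹ • ξ := fun τ => by
    have hlin : HasDerivAt (fun τ => (τ - s) / (t - s)) (t - s)⁻¹ τ := by
      simpa using ((hasDerivAt_id τ).sub_const s).div_const (t - s)
    exact ((hγ.differentiable (by norm_num) τ).hasDerivAt.add (hlin.smul_const ξ)).deriv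
  rw [kineticAction]
  simp only [hderiv]
  rw [kineticAction_add_const hγ, meanVelocity, real_inner_smul_left, real_inner_smul_left,
    real_inner_comm ξ, norm_smul, mul_pow, Real.norm_eq_abs, sq_abs]
  field_simp

lemma contDiff_stretch (hγ : ContDiff ℝ 1 γ) (s c : ℝ) : ContDiff ℝ 1 (stretch γ s c) := by
  unfold stretch
  fun_prop

lemma kineticAction_stretch (γ : ℝ → E) (s t : ℝ) {c : ℝ} (hc : c ≠ 0) :
    kineticAction s (s + c * (t - s)) (stretch γ s c) = c⁻¹ * kineticAction s t γ := by
  have hderiv : ∀ τ, deriv (stretch γ s c) τ = c⁻¹ • stretch (deriv γ) s c τ := fun τ => by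
    have h := deriv_comp_mul_left c⁻¹ (fun σ => γ (σ + (s - c⁻¹ * s))) τ
    rw [deriv_comp_add_const] at h
    unfold stretch
    rw [show s + c⁻¹ * (τ - s) = c⁻¹ * τ + (s - c⁻¹ * s) by ring, ← h]
    congr 1 with σ
    ring_nf
  have hnorm := integral_comp_stretch (fun p => ‖c⁻¹ • p.1‖ ^ 2 / 2) (deriv γ) s t hc
  simp only [kineticAction, hderiv]
  rw [hnorm]
  simp only [norm_smul, mul_pow, Real.norm_eq_abs, sq_abs, mul_div_assoc]
  rw [intervalIntegral.integral_const_mul]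
  field_simp

/-- The curve which runs from `y` at time `s` to `x` at time `t` with constant velocity. -/
def straightCurve (y x : E) (s t : ℝ) : ℝ → E := displace (fun _ => y) s t (x - y)

lemma contDiff_straightCurve (y x : E) (s t : ℝ) : ContDiff ℝ 1 (straightCurve y x s t) :=
  contDiff_displace contDiff_const s t _

@[simp] lemma straightCurve_left (y x : E) (s t : ℝ) : straightCurve y x s t s = y :=
  displace_left _ _ _ _

lemma straightCurve_right (y x : E) (hst : s ≠ t) : straightCurve y x s t t = x := by
  simp [straightCurve, displace_right _ hst]

lemma kineticAction_straightCurve (y x : E) (hst : s ≠ t) :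
    kineticAction s t (straightCurve y x s t) = ‖x - y‖ ^ 2 / (2 * (t - s)) := by
  rw [straightCurve, kineticAction_displace hst contDiff_const]
  simp [kineticAction, meanVelocity]

lemma straightCurve_mem_closedBall {x y : E} {p : E × ℝ} {r : ℝ}
    (hy : (y, s) ∈ Metric.closedBall p r) (hx : (x, t) ∈ Metric.closedBall p r) (hst : s ≠ t)
    (hτ : τ ∈ Icc s t) : (straightCurve y x s t τ, τ) ∈ Metric.closedBall p r := by
  have hs : 0 ≤ τ - s := sub_nonneg.2 hτ.1
  have ht : τ - s ≤ t - s := sub_le_sub_right hτ.2 s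
  convert (convex_closedBall p r).lineMap_mem hy hx
    ⟨div_nonneg hs (hs.trans ht), div_le_one_of_le₀ ht (hs.trans ht)⟩ using 1
  ext1
  · simp [straightCurve, displace, AffineMap.lineMap_apply, add_comm]
  · simp [AffineMap.lineMap_apply, div_mul_cancel₀ _ (sub_ne_zero.2 hst.symm)]

lemma norm_sub_straightCurve_le [CompleteSpace E] (hγ : ContDiff ℝ 1 γ) (hτ : τ ∈ Icc s t) :
    ‖γ τ - straightCurve (γ s) (γ t) s t τ‖ ≤
      ∫ σ in s..t, ‖deriv γ σ - meanVelocity s t γ‖ := by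
  have hc := hγ.continuous_deriv le_rfl
  have hint : ∫ σ in s..τ, (deriv γ σ - meanVelocity s t γ) =
      γ τ - straightCurve (γ s) (γ t) s t τ := by
    rw [intervalIntegral.integral_sub (hc.intervalIntegrable _ _) (by simp),
      intervalIntegral.integral_deriv_eq_sub (fun σ _ => hγ.differentiable (by norm_num) σ)
        (hc.intervalIntegrable _ _), intervalIntegral.integral_const, sub_sub, meanVelocity,
      smul_smul, ← div_eq_mul_inv, straightCurve, displace]
  rw [← hint]
  refine (intervalIntegral.norm_integral_le_integral_norm hτ.1).trans ?_
  exact intervalIntegral.integral_mono_interval le_rfl hτ.1 hτ.2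
    (Eventually.of_forall fun σ => norm_nonneg _)
    (Continuous.intervalIntegrable (by fun_prop) _ _)

lemma dist_curve_le [CompleteSpace E] {p : E × ℝ} {r : ℝ} (hγ : ContDiff ℝ 1 γ)
    (hs : (γ s, s) ∈ Metric.closedBall p r) (ht : (γ t, t) ∈ Metric.closedBall p r) (hst : s ≠ t)
    (hτ : τ ∈ Icc s t) :
    dist (γ τ, τ) p ≤ r + ∫ σ in s..t, ‖deriv γ σ - meanVelocity s t γ‖ := by
  have hdev : dist (γ τ, τ) (straightCurve (γ s) (γ t) s t τ, τ) ≤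
      ∫ σ in s..t, ‖deriv γ σ - meanVelocity s t γ‖ := by
    rw [dist_prod_same_right, dist_eq_norm]
    exact norm_sub_straightCurve_le hγ hτ
  linarith [dist_triangle (γ τ, τ) (straightCurve (γ s) (γ t) s t τ, τ) p,
    Metric.mem_closedBall.1 (straightCurve_mem_closedBall hs ht hst hτ)]

end Curves

section Pressure

variable {n : ℕ} {T B s t : ℝ} {L : ℝ≥0} {P : Space n × ℝ → ℝ} {γ : ℝ → Space n}

/-- `P` is bounded by `B` and `L`-Lipschitz on `ℝⁿ × [0,T]`, the distance on the product being the
maximum of the distances of the factors. -/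
structure IsLipschitzPressure (T B : ℝ) (L : ℝ≥0) (P : Space n × ℝ → ℝ) : Prop where
  bound : ∀ x, ∀ t ∈ Icc 0 T, |P (x, t)| ≤ B
  lipschitz : LipschitzOnWith L P (univ ×ˢ Icc 0 T)

lemma exists_latticeVector_norm_add_le (x : Space n) :
    ∃ z : Fin n → ℤ, ‖x + latticeVector z‖ ≤ √n := by
  refine ⟨fun i => -⌊x i⌋, ?_⟩
  rw [EuclideanSpace.norm_eq]
  refine Real.sqrt_le_sqrt ?_
  calc ∑ i, ‖(x + latticeVector fun i => -⌊x i⌋) i‖ ^ 2 ≤ ∑ _i : Fin n, (1 : ℝ) := by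
        refine Finset.sum_le_sum fun i _ => ?_
        have hfract : (x + latticeVector fun i => -⌊x i⌋) i = Int.fract (x i) := by
          simp [latticeVector, ← sub_eq_add_neg]
        rw [hfract, sq_le_one_iff_abs_le_one, abs_norm, Real.norm_of_nonneg (Int.fract_nonneg _)]
        exact (Int.fract_lt_one _).le
    _ = n := by simp

lemma lipschitzOnWith_of_abs_le_of_dist_le_one {X : Type*} [PseudoMetricSpace X] {f : X → ℝ}
    {S : Set X} {M K : ℝ≥0} (hM : ∀ x ∈ S, |f x| ≤ M)
    (hK : ∀ x ∈ S, ∀ y ∈ S, dist x y ≤ 1 → dist (f x) (f y) ≤ K * dist x y) :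
    LipschitzOnWith (K + 2 * M) f S := by
  refine LipschitzOnWith.of_dist_le_mul fun x hx y hy => ?_
  rw [NNReal.coe_add, NNReal.coe_mul, NNReal.coe_ofNat, add_mul]
  have hM' : 0 ≤ 2 * (M : ℝ) := by positivity
  rcases le_total (dist x y) 1 with h | h
  · exact (hK x hx y hy h).trans (le_add_of_nonneg_right (mul_nonneg hM' dist_nonneg))
  · have hfar : dist (f x) (f y) ≤ 2 * M := by
      rw [Real.dist_eq]
      linarith [abs_sub (f x) (f y), hM x hx, hM y hy]
    exact (hfar.trans (le_mul_of_one_le_right hM' h)).trans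
      (le_add_of_nonneg_left (mul_nonneg K.coe_nonneg dist_nonneg))

lemma exists_isLipschitzPressure (hPper : IsTorusFunction T P)
    (hP : ContDiffOn ℝ 1 P (univ ×ˢ Icc (0 : ℝ) T)) :
    ∃ B L, IsLipschitzPressure T B L P := by
  set S : Set (Space n × ℝ) := Metric.closedBall 0 (√n + 1) ×ˢ Icc (0 : ℝ) T
  have hSc : IsCompact S := (isCompact_closedBall _ _).prod isCompact_Icc
  have hSconv : Convex ℝ S := (convex_closedBall _ _).prod (convex_Icc _ _)
  have hPS : ContDiffOn ℝ 1 P S := hP.mono (prod_mono (subset_univ _) subset_rfl)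
  obtain ⟨B, hB⟩ := hSc.exists_bound_of_continuousOn hPS.continuousOn
  obtain ⟨L, hL⟩ := hPS.exists_lipschitzOnWith one_ne_zero hSconv hSc
  have hbound : ∀ x, ∀ t ∈ Icc 0 T, |P (x, t)| ≤ B := fun x t ht => by
    obtain ⟨z, hz⟩ := exists_latticeVector_norm_add_le x
    rw [← hPper z x t ht]
    exact hB _ ⟨by simpa using hz.trans (by linarith), ht⟩
  refine ⟨B, L + 2 * B.toNNReal, hbound, lipschitzOnWith_of_abs_le_of_dist_le_one
    (fun p hp => (hbound p.1 p.2 hp.2).trans B.le_coe_toNNReal) ?_⟩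
  rintro ⟨x, t⟩ ⟨-, ht⟩ ⟨y, s⟩ ⟨-, hs⟩ h
  obtain ⟨z, hz⟩ := exists_latticeVector_norm_add_le x
  have hxy : dist y x ≤ 1 := by
    rw [dist_comm]
    exact (le_max_left _ _).trans h
  have hxS : (x + latticeVector z, t) ∈ S := ⟨by simpa using hz.trans (by linarith), ht⟩
  have hyS : (y + latticeVector z, s) ∈ S := by
    refine ⟨(dist_triangle _ (x + latticeVector z) _).trans ?_, hs⟩
    rw [dist_add_right, dist_zero_right]
    linarith
  simpa only [hPper z x t ht, hPper z y s hs, Prod.dist_eq, dist_add_right]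
    using hL.dist_le_mul _ hxS _ hyS

namespace IsLipschitzPressure

lemma bound_nonneg (hP : IsLipschitzPressure T B L P) (hT : 0 ≤ T) : 0 ≤ B :=
  (abs_nonneg _).trans (hP.bound 0 0 ⟨le_rfl, hT⟩)

lemma abs_sub_le (hP : IsLipschitzPressure T B L P) {p q : Space n × ℝ} (hp : p.2 ∈ Icc 0 T)
    (hq : q.2 ∈ Icc 0 T) : |P p - P q| ≤ L * dist p q :=
  hP.lipschitz.dist_le_mul p ⟨mem_univ _, hp⟩ q ⟨mem_univ _, hq⟩

lemma intervalIntegrable_comp (hP : IsLipschitzPressure T B L P) (hst : s ≤ t)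
    (hγ : Continuous γ) {c : ℝ → ℝ} (hc : Continuous c)
    (hcT : MapsTo c (Icc s t) (Icc 0 T)) :
    IntervalIntegrable (fun τ => P (γ τ, c τ)) volume s t := by
  refine ContinuousOn.intervalIntegrable ?_
  rw [uIcc_of_le hst]
  exact hP.lipschitz.continuousOn.comp (by fun_prop) fun τ hτ => ⟨mem_univ _, hcT hτ⟩

end IsLipschitzPressure

end Pressure

section MinimalAction

variable {n : ℕ} {T B s t r : ℝ} {L : ℝ≥0} {P : Space n × ℝ → ℝ} {γ : ℝ → Space n}
  {x y : Space n} {p : Space n × ℝ}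

lemma exists_orbitAction_lt (P : Space n × ℝ → ℝ) (y x : Space n) (hst : s ≠ t) {ε : ℝ}
    (hε : 0 < ε) : ∃ γ : ℝ → Space n, ContDiff ℝ 1 γ ∧ γ s = y ∧ γ t = x ∧
      orbitAction P s t γ < minimalAction P y x s t + ε := by
  have hne : {A : ℝ | ∃ γ : ℝ → Space n,
      ContDiff ℝ 1 γ ∧ γ s = y ∧ γ t = x ∧ A = orbitAction P s t γ}.Nonempty :=
    ⟨_, straightCurve y x s t, contDiff_straightCurve y x s t, straightCurve_left y x s t,
      straightCurve_right y x hst, rfl⟩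
  obtain ⟨_, ⟨γ, hγ, hs, ht, rfl⟩, hlt⟩ := Real.lt_sInf_add_pos hne hε
  exact ⟨γ, hγ, hs, ht, hlt⟩

lemma le_minimalAction (hst : s ≠ t) {a : ℝ}
    (h : ∀ γ : ℝ → Space n, ContDiff ℝ 1 γ → γ s = y → γ t = x → a ≤ orbitAction P s t γ) :
    a ≤ minimalAction P y x s t := by
  refine le_of_forall_pos_le_add fun ε hε => ?_
  obtain ⟨γ, hγ, hs, ht, hlt⟩ := exists_orbitAction_lt P y x hst hε
  exact (h γ hγ hs ht).trans hlt.le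

namespace IsLipschitzPressure

lemma orbitAction_eq (hP : IsLipschitzPressure T B L P) (hs : 0 ≤ s) (hst : s ≤ t) (ht : t ≤ T)
    (hγ : ContDiff ℝ 1 γ) :
    orbitAction P s t γ = kineticAction s t γ + ∫ τ in s..t, P (γ τ, τ) := by
  have : Continuous (deriv γ) := hγ.continuous_deriv le_rfl
  exact intervalIntegral.integral_add (Continuous.intervalIntegrable (by fun_prop) _ _)
    (hP.intervalIntegrable_comp hst hγ.continuous continuous_id fun τ hτ =>
      ⟨hs.trans hτ.1, hτ.2.trans ht⟩)

lemma abs_integral_le (hP : IsLipschitzPressure T B L P) (hs : 0 ≤ s) (hst : s ≤ t) (ht : t ≤ T)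
    (γ : ℝ → Space n) : |∫ τ in s..t, P (γ τ, τ)| ≤ B * (t - s) := by
  rw [← Real.norm_eq_abs, ← abs_of_nonneg (sub_nonneg.2 hst)]
  refine intervalIntegral.norm_integral_le_of_norm_le_const fun τ hτ => ?_
  rw [uIoc_of_le hst] at hτ
  exact hP.bound _ _ ⟨hs.trans hτ.1.le, hτ.2.trans ht⟩

lemma le_orbitAction (hP : IsLipschitzPressure T B L P) (hs : 0 ≤ s) (hst : s < t) (ht : t ≤ T)
    (hγ : ContDiff ℝ 1 γ) :
    ‖γ t - γ s‖ ^ 2 / (2 * (t - s)) - B * (t - s) ≤ orbitAction P s t γ := by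
  rw [hP.orbitAction_eq hs hst.le ht hγ, kineticAction_eq_add_excessAction hst.ne hγ]
  linarith [neg_le_of_abs_le (hP.abs_integral_le hs hst.le ht γ),
    excessAction_nonneg (γ := γ) hst.le]

lemma le_minimalAction (hP : IsLipschitzPressure T B L P) (hs : 0 ≤ s) (hst : s < t) (ht : t ≤ T) :
    ‖x - y‖ ^ 2 / (2 * (t - s)) - B * (t - s) ≤ minimalAction P y x s t := by
  refine HamiltonJacobi.le_minimalAction hst.ne fun γ hγ hγs hγt => ?_
  rw [← hγs, ← hγt]
  exact hP.le_orbitAction hs hst ht hγ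

lemma minimalAction_le_orbitAction (hP : IsLipschitzPressure T B L P) (hs : 0 ≤ s) (hst : s < t)
    (ht : t ≤ T) (hγ : ContDiff ℝ 1 γ) :
    minimalAction P (γ s) (γ t) s t ≤ orbitAction P s t γ := by
  refine csInf_le ⟨-(B * (t - s)), ?_⟩ ⟨γ, hγ, rfl, rfl, rfl⟩
  rintro _ ⟨γ, hγ, -, -, rfl⟩
  have hkin : 0 ≤ ‖γ t - γ s‖ ^ 2 / (2 * (t - s)) :=
    div_nonneg (sq_nonneg _) (by linarith)
  linarith [hP.le_orbitAction hs hst ht hγ]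

lemma minimalAction_le_straightCurve (hP : IsLipschitzPressure T B L P) (hs : 0 ≤ s) (hst : s < t)
    (ht : t ≤ T) : minimalAction P y x s t ≤
      ‖x - y‖ ^ 2 / (2 * (t - s)) + ∫ τ in s..t, P (straightCurve y x s t τ, τ) := by
  have h := hP.minimalAction_le_orbitAction hs hst ht (contDiff_straightCurve y x s t)
  rwa [straightCurve_left, straightCurve_right y x hst.ne, hP.orbitAction_eq hs hst.le ht
    (contDiff_straightCurve y x s t), kineticAction_straightCurve y x hst.ne] at h

lemma minimalAction_le (hP : IsLipschitzPressure T B L P) (hs : 0 ≤ s) (hst : s < t) (ht : t ≤ T) :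
    minimalAction P y x s t ≤ ‖x - y‖ ^ 2 / (2 * (t - s)) + B * (t - s) :=
  (hP.minimalAction_le_straightCurve hs hst ht).trans
    (by gcongr; exact le_of_abs_le (hP.abs_integral_le hs hst.le ht _))

lemma abs_integral_sub_le (hP : IsLipschitzPressure T B L P) (hs : 0 ≤ s) (hst : s ≤ t)
    (ht : t ≤ T) (hp : p.2 ∈ Icc 0 T) (hγ : Continuous γ)
    (hdist : ∀ τ ∈ Icc s t, dist (γ τ, τ) p ≤ r) :
    |(∫ τ in s..t, P (γ τ, τ)) - (t - s) * P p| ≤ (t - s) * (L * r) := by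
  have hT : MapsTo id (Icc s t) (Icc 0 T) := fun τ hτ => ⟨hs.trans hτ.1, hτ.2.trans ht⟩
  have hint : IntervalIntegrable (fun τ => P (γ τ, τ)) volume s t :=
    hP.intervalIntegrable_comp hst hγ continuous_id hT
  rw [← smul_eq_mul (t - s) (P p), ← intervalIntegral.integral_const,
    ← intervalIntegral.integral_sub hint (by simp), mul_comm (t - s),
    ← Real.norm_eq_abs, ← abs_of_nonneg (sub_nonneg.2 hst)]
  refine intervalIntegral.norm_integral_le_of_norm_le_const fun τ hτ => ?_
  rw [uIoc_of_le hst] at hτ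
  have hτ' := Ioc_subset_Icc_self hτ
  exact (hP.abs_sub_le (hT hτ') hp).trans (by gcongr; exact hdist τ hτ')

lemma minimalAction_le_of_mem_closedBall (hP : IsLipschitzPressure T B L P) (hs : 0 ≤ s)
    (hst : s < t) (ht : t ≤ T) (hp : p.2 ∈ Icc 0 T) (hy : (y, s) ∈ Metric.closedBall p r)
    (hx : (x, t) ∈ Metric.closedBall p r) :
    minimalAction P y x s t ≤ ‖x - y‖ ^ 2 / (2 * (t - s)) + (t - s) * (P p + L * r) := by
  have h := abs_le.1 <| hP.abs_integral_sub_le hs hst.le ht hp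
    (contDiff_straightCurve y x s t).continuous
    fun τ hτ => straightCurve_mem_closedBall hy hx hst.ne hτ
  linarith [h.2, hP.minimalAction_le_straightCurve (x := x) (y := y) hs hst ht]

/-- The excess action absorbs the variation of `P` caused by the deviation of `γ` from the
straight curve, since `L δ |v| ≤ |v|² / 4 + L² δ²` with `δ = t - s`. -/
lemma le_orbitAction_of_mem_closedBall (hP : IsLipschitzPressure T B L P) (hs : 0 ≤ s)
    (hst : s < t) (ht : t ≤ T) (hp : p.2 ∈ Icc 0 T) (hγ : ContDiff ℝ 1 γ)
    (hγs : (γ s, s) ∈ Metric.closedBall p r) (hγt : (γ t, t) ∈ Metric.closedBall p r) :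
    ‖γ t - γ s‖ ^ 2 / (2 * (t - s)) + excessAction s t γ / 2 +
      (t - s) * (P p - L * r) - L ^ 2 * (t - s) ^ 3 ≤ orbitAction P s t γ := by
  have : Continuous (deriv γ) := hγ.continuous_deriv le_rfl
  have hpot := neg_le_of_abs_le <| hP.abs_integral_sub_le hs hst.le ht hp hγ.continuous
    fun τ hτ => dist_curve_le hγ hγs hγt hst.ne hτ
  have hdev : (t - s) * L * ∫ τ in s..t, ‖deriv γ τ - meanVelocity s t γ‖ ≤
      excessAction s t γ / 2 + (t - s) * (L ^ 2 * (t - s) ^ 2) := by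
    rw [excessAction, ← intervalIntegral.integral_const_mul, ← intervalIntegral.integral_div,
      ← smul_eq_mul (t - s) (L ^ 2 * (t - s) ^ 2 : ℝ), ← intervalIntegral.integral_const,
      ← intervalIntegral.integral_add (Continuous.intervalIntegrable (by fun_prop) _ _) (by simp)]
    refine intervalIntegral.integral_mono_on hst.le
      (Continuous.intervalIntegrable (by fun_prop) _ _)
      (Continuous.intervalIntegrable (by fun_prop) _ _) fun τ _ => ?_
    nlinarith [sq_nonneg (‖deriv γ τ - meanVelocity s t γ‖ / 2 - L * (t - s))]
  rw [hP.orbitAction_eq hs hst.le ht hγ, kineticAction_eq_add_excessAction hst.ne hγ]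
  linarith

lemma le_minimalAction_of_mem_closedBall (hP : IsLipschitzPressure T B L P) (hs : 0 ≤ s)
    (hst : s < t) (ht : t ≤ T) (hp : p.2 ∈ Icc 0 T) (hy : (y, s) ∈ Metric.closedBall p r)
    (hx : (x, t) ∈ Metric.closedBall p r) :
    ‖x - y‖ ^ 2 / (2 * (t - s)) + (t - s) * (P p - L * r) - L ^ 2 * (t - s) ^ 3 ≤
      minimalAction P y x s t := by
  refine HamiltonJacobi.le_minimalAction hst.ne ?_
  rintro γ hγ rfl rfl
  linarith [hP.le_orbitAction_of_mem_closedBall hs hst ht hp hγ hy hx,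
    excessAction_nonneg (γ := γ) hst.le]

end IsLipschitzPressure

end MinimalAction

section EndPointVariation

variable {n : ℕ} {T B R s t : ℝ} {L : ℝ≥0} {P : Space n × ℝ → ℝ} {γ : ℝ → Space n}
  {x y : Space n} {p : Space n × ℝ}

/-- The covector `(v, c)` with `c + |v|²/2 = P p`: a candidate for the full derivative at `p` of a
solution with spatial gradient `v`. -/
def hjCovector (P : Space n × ℝ → ℝ) (p : Space n × ℝ) (v : Space n) : Space n × ℝ →L[ℝ] ℝ :=
  (innerSL ℝ v).coprod ((P p - ‖v‖ ^ 2 / 2) • ContinuousLinearMap.id ℝ ℝ)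

@[simp] lemma hjCovector_apply (P : Space n × ℝ → ℝ) (p : Space n × ℝ) (v : Space n)
    (z : Space n × ℝ) :
    hjCovector P p v z = inner ℝ v z.1 + (P p - ‖v‖ ^ 2 / 2) * z.2 := by
  simp [hjCovector]

lemma continuous_hjCovector (P : Space n × ℝ → ℝ) (p : Space n × ℝ) :
    Continuous (hjCovector P p) := by
  unfold hjCovector
  fun_prop

lemma inv_one_add_le {θ : ℝ} (hθ : |θ| ≤ 1 / 2) : (1 + θ)⁻¹ ≤ 1 - θ + 2 * θ ^ 2 := by
  have hθ' := abs_le.1 hθ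
  rw [inv_le_iff_one_le_mul₀ (by linarith)]
  nlinarith [sq_nonneg θ]

/-- Expansion of the varied action in the relative change `θ` of the duration `δ`. Here `K` and
`A` are the kinetic and the total action of a curve, `h` approximates its Lagrangian, `w + κ` is
the change of the kinetic action under a spatial variation of size `r`, and `ρ = r² / δ`. -/
lemma varied_action_le {A K C δ h l r w κ θ ρ : ℝ} (hδ : 0 < δ) (hr : 0 ≤ r) (hC : 0 ≤ C)
    (hl : 0 ≤ l) (hR : 0 ≤ R) (hκ : 0 ≤ κ) (hρ : ρ * δ = r ^ 2) (hκρ : 2 * κ ≤ ρ)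
    (hθ : |θ| ≤ 1 / 2) (hθr : |θ| * δ ≤ r) (hw : |w| ≤ R * r) (hK : 0 ≤ K + w + κ)
    (hKC : K ≤ C * δ) (hA : |A - 2 * K - δ * h| ≤ C * δ ^ 2) :
    (1 + θ)⁻¹ * (K + w + κ) + (1 + θ) * (A - K + δ * (l * r)) ≤
      A + w + h * (θ * δ) + (2 * C + 2 * l + 2 * R + 1) * (δ * r + ρ) := by
  have hθ' := abs_le.1 hθ
  have hθρ : |θ| * r ≤ ρ := by
    rw [← mul_le_mul_iff_left₀ hδ, hρ]
    nlinarith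
  have hθδ : θ ^ 2 * δ ≤ ρ := by
    rw [← sq_abs]
    nlinarith [abs_nonneg θ]
  have hθw : |θ * w| ≤ R * ρ := by
    rw [abs_mul]
    nlinarith [abs_nonneg θ]
  have hθ2w : 2 * θ ^ 2 * w ≤ R * ρ := by
    have h2θ : |2 * θ| ≤ 1 := by
      rw [abs_mul, abs_two]
      linarith
    calc 2 * θ ^ 2 * w ≤ |2 * θ * (θ * w)| := le_trans (by linarith) (le_abs_self _)
      _ = |2 * θ| * |θ * w| := abs_mul _ _
      _ ≤ R * ρ := (mul_le_of_le_one_left (abs_nonneg _) h2θ).trans hθw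
  have hθA : θ * (A - 2 * K - δ * h) ≤ C * (δ * r) := by
    refine (le_abs_self _).trans ?_
    rw [abs_mul]
    calc |θ| * |A - 2 * K - δ * h| ≤ |θ| * (C * δ ^ 2) := by gcongr
      _ = C * (δ * (|θ| * δ)) := by ring
      _ ≤ C * (δ * r) := by gcongr
  have hθK : 2 * θ ^ 2 * K ≤ 2 * C * ρ := by nlinarith [sq_nonneg θ]
  have hθκ : -(θ * κ) + 2 * θ ^ 2 * κ ≤ κ := by
    have : 0 ≤ (1 - θ) * (1 + 2 * θ) := mul_nonneg (by linarith) (by linarith)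
    linarith [mul_nonneg hκ this]
  have hθl : θ * (δ * (l * r)) ≤ δ * (l * r) :=
    mul_le_of_le_one_left (by positivity) (by linarith)
  have hCr : 0 ≤ C * (δ * r) := by positivity
  have hRr : 0 ≤ R * (δ * r) := by positivity
  have hlr : 0 ≤ δ * r := by positivity
  have hlρ : 0 ≤ l * ρ := mul_nonneg hl (by linarith)
  linarith [mul_le_mul_of_nonneg_right (inv_one_add_le hθ) hK, neg_le_of_abs_le hθw]

namespace IsLipschitzPressure

lemma excessAction_le (hP : IsLipschitzPressure T B L P) (hs : 0 ≤ s) (hst : s < t) (ht : t ≤ T)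
    (hγ : ContDiff ℝ 1 γ) (hp : p.2 ∈ Icc 0 T) {r : ℝ}
    (hγs : (γ s, s) ∈ Metric.closedBall p r) (hγt : (γ t, t) ∈ Metric.closedBall p r) {ε : ℝ}
    (hmin : orbitAction P s t γ ≤ minimalAction P (γ s) (γ t) s t + ε) :
    excessAction s t γ ≤ 4 * ((t - s) * (L * r)) + 2 * (L ^ 2 * (t - s) ^ 3) + 2 * ε := by
  linarith [hP.minimalAction_le_of_mem_closedBall hs hst ht hp hγs hγt,
    hP.le_orbitAction_of_mem_closedBall hs hst ht hp hγ hγs hγt]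

lemma exists_kineticAction_le (hP : IsLipschitzPressure T B L P) (hR : 0 ≤ R) :
    ∃ C, 0 ≤ C ∧ ∀ (s t : ℝ) (γ : ℝ → Space n), 0 ≤ s → s < t → t ≤ T → t - s ≤ 1 →
      ContDiff ℝ 1 γ → ‖meanVelocity s t γ‖ ≤ R →
      orbitAction P s t γ ≤ minimalAction P (γ s) (γ t) s t + (t - s) ^ 2 →
      kineticAction s t γ ≤ C * (t - s) ∧
      |orbitAction P s t γ - 2 * kineticAction s t γ -
        (t - s) * (P (γ t, t) - ‖meanVelocity s t γ‖ ^ 2 / 2)| ≤ C * (t - s) ^ 2 := by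
  set M : ℝ := 2 * (L * (1 + R)) + L ^ 2 + 1 with hM
  refine ⟨R ^ 2 / 2 + 4 * M, by positivity, ?_⟩
  intro s t γ hs hst ht hδ hγ hR' hmin
  have h0 : 0 < t - s := sub_pos.2 hst
  have hT : (γ t, t).2 ∈ Icc 0 T := ⟨(hs.trans_lt hst).le, ht⟩
  have hγt : (γ t, t) ∈ Metric.closedBall (γ t, t) ((1 + R) * (t - s)) :=
    Metric.mem_closedBall_self (by positivity)
  have hγs := mem_closedBall_of_norm_meanVelocity_le hst hR'
  have hupper := hP.minimalAction_le_of_mem_closedBall hs hst ht hT hγs hγt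
  have hlower := hP.le_orbitAction_of_mem_closedBall hs hst ht hT hγ hγs hγt
  rw [norm_sub_sq_div_eq hst.ne] at hupper hlower
  have hcube : (L : ℝ) ^ 2 * (t - s) ^ 3 ≤ L ^ 2 * (t - s) ^ 2 := by
    gcongr ?_ * ?_
    exact pow_le_pow_of_le_one h0.le hδ (by norm_num)
  have hexcess : excessAction s t γ ≤ 2 * M * (t - s) ^ 2 := by
    rw [hM]
    linarith [hP.excessAction_le hs hst ht hγ hT hγs hγt hmin]
  have hR2 : 0 ≤ R ^ 2 * (t - s) ^ 2 := by positivity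
  have hLR : 0 ≤ L * (1 + R) * (t - s) ^ 2 := by positivity
  rw [kineticAction_eq_add_excessAction hst.ne hγ, norm_sub_sq_div_eq hst.ne]
  constructor
  · have hsq : M * (t - s) ^ 2 ≤ M * (t - s) := by
      gcongr
      nlinarith
    have hu : (t - s) * ‖meanVelocity s t γ‖ ^ 2 ≤ (t - s) * R ^ 2 := by gcongr
    have hMδ : 0 ≤ M * (t - s) := by positivity
    linarith [hexcess]
  · have hMδ : M * (t - s) ^ 2 =
        2 * (L * (1 + R) * (t - s) ^ 2) + L ^ 2 * (t - s) ^ 2 + (t - s) ^ 2 := by ring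
    have hδ2 := sq_nonneg (t - s)
    have hL2 : 0 ≤ (L : ℝ) ^ 2 * (t - s) ^ 2 := by positivity
    exact abs_le.2 ⟨by linarith [hexcess, hMδ],
      by linarith [hMδ, excessAction_nonneg (γ := γ) hst.le]⟩

lemma orbitAction_stretch_displace_le (hP : IsLipschitzPressure T B L P) (hs : 0 ≤ s)
    (hst : s < t) (ht : t ≤ T) (hγ : ContDiff ℝ 1 γ) {z : Space n × ℝ}
    (hz : |z.2| ≤ (t - s) / 2) (hzT : t + z.2 ≤ T) {c : ℝ} (hc : c = 1 + z.2 / (t - s)) :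
    orbitAction P s (t + z.2) (stretch (displace γ s t z.1) s c) ≤
      c⁻¹ * kineticAction s t (displace γ s t z.1) +
      c * (orbitAction P s t γ - kineticAction s t γ + (t - s) * (L * ‖z‖)) := by
  have h0 : 0 < t - s := sub_pos.2 hst
  have hz' := neg_le_of_abs_le hz
  have hend : t + z.2 = s + c * (t - s) := by
    rw [hc]
    field_simp
    ring
  have hcpos : 0 < c := by nlinarith
  have hγ' := contDiff_displace hγ s t z.1
  have hid : MapsTo id (Icc s t) (Icc 0 T) := fun τ hτ => ⟨hs.trans hτ.1, hτ.2.trans ht⟩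
  have hclock : MapsTo (fun τ => s + c * (τ - s)) (Icc s t) (Icc 0 T) := fun τ hτ =>
    ⟨by nlinarith [hτ.1], by nlinarith [hτ.2]⟩
  have hint : IntervalIntegrable (fun τ => P (γ τ, τ)) volume s t :=
    hP.intervalIntegrable_comp hst.le hγ.continuous continuous_id hid
  have hpot : ∫ τ in s..t, P (displace γ s t z.1 τ, s + c * (τ - s)) ≤
      (∫ τ in s..t, P (γ τ, τ)) + (t - s) * (L * ‖z‖) := by
    rw [← smul_eq_mul (t - s), ← intervalIntegral.integral_const,
      ← intervalIntegral.integral_add hint (by simp)]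
    refine intervalIntegral.integral_mono_on hst.le (hP.intervalIntegrable_comp hst.le
      hγ'.continuous (by fun_prop) hclock) (hint.add (by simp)) fun τ hτ => ?_
    have hLip := hP.abs_sub_le (p := (displace γ s t z.1 τ, s + c * (τ - s))) (q := (γ τ, τ))
      (hclock hτ) (hid hτ)
    have hdist : dist (displace γ s t z.1 τ, s + c * (τ - s)) (γ τ, τ) ≤ ‖z‖ := by
      rw [hc]
      exact dist_displace_stretch_le γ hst z hτ
    exact sub_le_iff_le_add'.1 <| (le_of_abs_le hLip).trans (by gcongr)
  rw [hP.orbitAction_eq hs (by nlinarith) hzT (contDiff_stretch hγ' s c), hend,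
    kineticAction_stretch _ s t hcpos.ne', integral_comp_stretch P _ s t hcpos.ne',
    hP.orbitAction_eq hs hst.le ht hγ, add_sub_cancel_left]
  gcongr

lemma minimalAction_stretch_displace_le (hP : IsLipschitzPressure T B L P) (hs : 0 ≤ s)
    (hst : s < t) (ht : t ≤ T) (hγ : ContDiff ℝ 1 γ) {z : Space n × ℝ}
    (hz : |z.2| ≤ (t - s) / 2) (hzT : t + z.2 ≤ T) :
    minimalAction P (γ s) (γ t + z.1) s (t + z.2) ≤
      (1 + z.2 / (t - s))⁻¹ * (kineticAction s t γ + inner ℝ (meanVelocity s t γ) z.1 +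
        ‖z.1‖ ^ 2 / (2 * (t - s))) +
      (1 + z.2 / (t - s)) *
        (orbitAction P s t γ - kineticAction s t γ + (t - s) * (L * ‖z‖)) := by
  have h0 : 0 < t - s := sub_pos.2 hst
  have hz' := neg_le_of_abs_le hz
  set c : ℝ := 1 + z.2 / (t - s) with hc
  have hend : s + c * (t - s) = t + z.2 := by
    rw [hc]
    field_simp
    ring
  have hcpos : 0 < c := by nlinarith
  have h := hP.minimalAction_le_orbitAction hs (by linarith) hzT
    (contDiff_stretch (contDiff_displace hγ s t z.1) s c)
  rw [stretch_left, displace_left, ← hend, stretch_right _ s t hcpos.ne',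
    displace_right γ hst.ne, hend] at h
  rw [← kineticAction_displace hst.ne hγ]
  exact h.trans (hP.orbitAction_stretch_displace_le hs hst ht hγ hz hzT hc)

/-- The velocity of a nearly minimal curve ending at `(x, t)` is the initial slope of the minimal
action in the end point, up to errors which are small compared to `‖z‖` when first `t - s` and
then `‖z‖ / (t - s)` is small. -/
lemma exists_minimalAction_add_le (hP : IsLipschitzPressure T B L P) (hR : 0 ≤ R) :
    ∃ C, 0 ≤ C ∧ ∀ (x y : Space n) (s t : ℝ) (z : Space n × ℝ), 0 ≤ s → s < t → t ≤ T →
      t - s ≤ 1 → ‖(t - s)⁻¹ • (x - y)‖ ≤ R → |z.2| ≤ (t - s) / 2 → t + z.2 ≤ T →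
      minimalAction P y (x + z.1) s (t + z.2) ≤ minimalAction P y x s t +
        hjCovector P (x, t) ((t - s)⁻¹ • (x - y)) z +
        C * ((t - s) * ‖z‖ + ‖z‖ ^ 2 / (t - s)) := by
  obtain ⟨C, hC, hnear⟩ := hP.exists_kineticAction_le hR
  refine ⟨2 * C + 2 * L + 2 * R + 1, by positivity, ?_⟩
  intro x y s t z hs hst ht hδ hu hz hzT
  have h0 : 0 < t - s := sub_pos.2 hst
  refine le_of_forall_pos_le_add fun ε hε => ?_
  obtain ⟨γ, hγ, rfl, rfl, hlt⟩ := exists_orbitAction_lt P y x hst.ne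
    (lt_min hε (pow_pos h0 2))
  obtain ⟨hkin, haction⟩ := hnear s t γ hs hst ht hδ hγ hu
    (hlt.le.trans (by gcongr; exact min_le_right _ _))
  change ‖meanVelocity s t γ‖ ≤ R at hu
  change _ ≤ _ + hjCovector P _ (meanVelocity s t γ) z + _ + _
  have hzr := norm_snd_le z
  have hzx := norm_fst_le z
  rw [Real.norm_eq_abs] at hzr
  have hθ : |z.2 / (t - s)| = |z.2| / (t - s) := by rw [abs_div, abs_of_pos h0]
  have hkin' : 0 ≤ kineticAction s t γ + inner ℝ (meanVelocity s t γ) z.1 +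
      ‖z.1‖ ^ 2 / (2 * (t - s)) := by
    rw [← kineticAction_displace hst.ne hγ]
    exact intervalIntegral.integral_nonneg hst.le fun τ _ => by positivity
  have hκ : 2 * (‖z.1‖ ^ 2 / (2 * (t - s))) ≤ ‖z‖ ^ 2 / (t - s) := by
    rw [← mul_div_assoc, mul_div_mul_left _ _ two_ne_zero]
    gcongr
  have hvaried := varied_action_le (h := P (γ t, t) - ‖meanVelocity s t γ‖ ^ 2 / 2)
    (r := ‖z‖) (θ := z.2 / (t - s)) h0 (norm_nonneg z) hC L.coe_nonneg hR (by positivity)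
    (div_mul_cancel₀ _ h0.ne') hκ
    (by rw [hθ, div_le_iff₀ h0]; linarith) (by rwa [hθ, div_mul_cancel₀ _ h0.ne'])
    ((abs_real_inner_le_norm _ _).trans (by gcongr)) hkin' hkin haction
  rw [div_mul_cancel₀ _ h0.ne'] at hvaried
  have hupper := (hP.minimalAction_stretch_displace_le hs hst ht hγ hz hzT).trans hvaried
  rw [hjCovector_apply]
  linarith [min_le_left ε ((t - s) ^ 2)]

end IsLipschitzPressure

end EndPointVariation

section Semiconcavity

variable {n : ℕ} {T B s t : ℝ} {L : ℝ≥0} {P : Space n × ℝ → ℝ} {γ : ℝ → Space n} {κ : ℝ → ℝ}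

namespace IsLipschitzPressure

lemma integral_displace_add_le (hP : IsLipschitzPressure T B L P) (hs : 0 ≤ s) (hst : s < t)
    (ht : t ≤ T) (hγ : ContDiff ℝ 1 γ) (hκ : IntervalIntegrable κ volume s t)
    (hκ0 : ∀ τ ∈ Icc s t, 0 ≤ κ τ)
    (hPκ : ∀ τ ∈ Icc s t, StrongConcaveOn univ (-κ τ) fun x => P (x, τ))
    (d : Space n) {a b : ℝ} (ha : 0 ≤ a) (hb : 0 ≤ b) (hab : a + b = 1) :
    a * (∫ τ in s..t, P (displace γ s t (b • d) τ, τ)) +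
        b * (∫ τ in s..t, P (displace γ s t (-(a • d)) τ, τ)) ≤
      (∫ τ in s..t, P (γ τ, τ)) + (∫ τ in s..t, κ τ) * (a * b / 2 * ‖d‖ ^ 2) := by
  have hT : MapsTo id (Icc s t) (Icc 0 T) := fun τ hτ => ⟨hs.trans hτ.1, hτ.2.trans ht⟩
  have hint : ∀ c : ℝ → Space n, ContDiff ℝ 1 c →
      IntervalIntegrable (fun τ => P (c τ, τ)) volume s t := fun c hc =>
    hP.intervalIntegrable_comp hst.le hc.continuous continuous_id hT
  have h₁ := (hint _ (contDiff_displace hγ s t (b • d))).const_mul a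
  have h₂ := (hint _ (contDiff_displace hγ s t (-(a • d)))).const_mul b
  have hκ' := hκ.mul_const (a * b / 2 * ‖d‖ ^ 2)
  rw [← intervalIntegral.integral_const_mul, ← intervalIntegral.integral_const_mul,
    ← intervalIntegral.integral_mul_const, ← intervalIntegral.integral_add h₁ h₂,
    ← intervalIntegral.integral_add (hint γ hγ) hκ']
  refine intervalIntegral.integral_mono_on hst.le (h₁.add h₂) ((hint γ hγ).add hκ')
    fun τ hτ => ?_
  set l : ℝ := (τ - s) / (t - s) with hl
  have hl0 : 0 ≤ l := div_nonneg (sub_nonneg.2 hτ.1) (sub_nonneg.2 hst.le)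
  have hl1 : l ≤ 1 := div_le_one_of_le₀ (by linarith [hτ.2]) (sub_nonneg.2 hst.le)
  have h := (hPκ τ hτ).2 (mem_univ (displace γ s t (b • d) τ))
    (mem_univ (displace γ s t (-(a • d)) τ)) ha hb hab
  have hdiff : displace γ s t (b • d) τ - displace γ s t (-(a • d)) τ = l • d := by
    simp only [displace, ← hl, smul_neg, add_sub_add_left_eq_sub, sub_neg_eq_add, ← smul_add,
      ← add_smul, add_comm b, hab, one_smul]
  have hmean : a • displace γ s t (b • d) τ + b • displace γ s t (-(a • d)) τ = γ τ := by
    obtain rfl : b = 1 - a := by linarith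
    simp only [displace, ← hl]
    module
  rw [hdiff, hmean, norm_smul, Real.norm_of_nonneg hl0, smul_eq_mul, smul_eq_mul] at h
  have hcoef : 0 ≤ κ τ * (a * b / 2 * ‖d‖ ^ 2) :=
    mul_nonneg (hκ0 τ hτ) (by positivity)
  have hl2 : l ^ 2 * (κ τ * (a * b / 2 * ‖d‖ ^ 2)) ≤ κ τ * (a * b / 2 * ‖d‖ ^ 2) :=
    mul_le_of_le_one_left hcoef (pow_le_one₀ hl0 hl1)
  linarith

lemma minimalAction_add_le (hP : IsLipschitzPressure T B L P) (hs : 0 ≤ s) (hst : s < t)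
    (ht : t ≤ T) (hγ : ContDiff ℝ 1 γ) (ξ : Space n) :
    minimalAction P (γ s) (γ t + ξ) s t ≤
      kineticAction s t γ + inner ℝ (meanVelocity s t γ) ξ + ‖ξ‖ ^ 2 / (2 * (t - s)) +
        ∫ τ in s..t, P (displace γ s t ξ τ, τ) := by
  have hξ := contDiff_displace hγ s t ξ
  have h := hP.minimalAction_le_orbitAction hs hst ht hξ
  rwa [displace_left, displace_right γ hst.ne, hP.orbitAction_eq hs hst.le ht hξ,
    kineticAction_displace hst.ne hγ] at h

lemma strongConcaveOn_minimalAction (hP : IsLipschitzPressure T B L P) (hs : 0 ≤ s)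
    (hst : s < t) (ht : t ≤ T) (hκ : IntervalIntegrable κ volume s t)
    (hκ0 : ∀ τ ∈ Icc s t, 0 ≤ κ τ)
    (hPκ : ∀ τ ∈ Icc s t, StrongConcaveOn univ (-κ τ) fun x => P (x, τ)) (y : Space n) :
    StrongConcaveOn univ (-(1 / (t - s) + ∫ τ in s..t, κ τ))
      fun x => minimalAction P y x s t := by
  refine ⟨convex_univ, fun x₁ _ x₂ _ a b ha hb hab => le_of_forall_pos_le_add fun ε hε => ?_⟩
  obtain ⟨γ, hγ, rfl, hγt, hlt⟩ := exists_orbitAction_lt P y (a • x₁ + b • x₂) hst.ne hε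
  have hx₁ : γ t + b • (x₁ - x₂) = x₁ := by
    obtain rfl : b = 1 - a := by linarith
    rw [hγt]
    module
  have hx₂ : γ t + -(a • (x₁ - x₂)) = x₂ := by
    obtain rfl : b = 1 - a := by linarith
    rw [hγt]
    module
  have h₁ := mul_le_mul_of_nonneg_left
    (hP.minimalAction_add_le hs hst ht hγ (b • (x₁ - x₂))) ha
  have h₂ := mul_le_mul_of_nonneg_left
    (hP.minimalAction_add_le hs hst ht hγ (-(a • (x₁ - x₂)))) hb
  rw [hx₁, inner_smul_right, norm_smul, Real.norm_of_nonneg hb] at h₁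
  rw [hx₂, inner_neg_right, inner_smul_right, norm_neg, norm_smul, Real.norm_of_nonneg ha] at h₂
  rw [hP.orbitAction_eq hs hst.le ht hγ] at hlt
  have hpot := hP.integral_displace_add_le hs hst ht hγ hκ hκ0 hPκ (x₁ - x₂) ha hb hab
  have hsq : a * ((b * ‖x₁ - x₂‖) ^ 2 / (2 * (t - s))) +
      b * ((a * ‖x₁ - x₂‖) ^ 2 / (2 * (t - s))) =
      1 / (t - s) * (a * b / 2 * ‖x₁ - x₂‖ ^ 2) := by
    have h0 : t - s ≠ 0 := sub_ne_zero.2 hst.ne'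
    obtain rfl : b = 1 - a := by linarith
    field_simp
    ring
  have hmean : ∀ A : ℝ, a * A + b * A = A := fun A => by rw [← add_mul, hab, one_mul]
  simp only [smul_eq_mul]
  linarith [hmean (kineticAction s t γ)]

end IsLipschitzPressure

end Semiconcavity

section ForwardSolution

variable {n : ℕ} {T B a b s t ε : ℝ} {L K : ℝ≥0} {P φ : Space n × ℝ → ℝ} {x y : Space n}
  {p : Space n × ℝ}

lemma IsLipschitzPressure.norm_velocity_le (hP : IsLipschitzPressure T B L P) (hs : 0 ≤ s)
    (hst : s < t) (ht : t ≤ T) {A : ℝ} (hA : minimalAction P y x s t ≤ A) :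
    ‖(t - s)⁻¹ • (x - y)‖ ≤ √((A + B * (t - s)) * (2 * (t - s))) / (t - s) := by
  have h0 : 0 < t - s := sub_pos.2 hst
  rw [norm_smul, norm_inv, Real.norm_of_nonneg h0.le, inv_mul_eq_div]
  gcongr
  refine Real.le_sqrt_of_sq_le ((div_le_iff₀ (by positivity)).1 ?_)
  linarith [hP.le_minimalAction (x := x) (y := y) hs hst ht]

namespace IsForwardSolution

lemma le_minimalAction_add (hφ : IsForwardSolution T P φ) (hs : 0 ≤ s) (hst : s < t) (ht : t ≤ T)
    (y x : Space n) : φ (x, t) ≤ minimalAction P y x s t + φ (y, s) :=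
  (hφ.isGLB x s ⟨hs, hst.le.trans ht⟩ t ⟨(hs.trans_lt hst).le, ht⟩ hst).1 (mem_range_self y)

lemma exists_minimalAction_add_lt (hφ : IsForwardSolution T P φ) (hs : 0 ≤ s) (hst : s < t)
    (ht : t ≤ T) (x : Space n) (hε : 0 < ε) :
    ∃ y, minimalAction P y x s t + φ (y, s) < φ (x, t) + ε := by
  obtain ⟨_, ⟨y, rfl⟩, -, hy⟩ := (hφ.isGLB x s ⟨hs, hst.le.trans ht⟩ t
    ⟨(hs.trans_lt hst).le, ht⟩ hst).exists_between (lt_add_of_pos_right _ hε)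
  exact ⟨y, hy⟩

lemma exists_forall_le (hφ : IsForwardSolution T P φ) (hP : IsLipschitzPressure T B L P)
    (ha : 0 < a) : ∃ M, ∀ x, ∀ t ∈ Icc a T, φ (x, t) ≤ M := by
  refine ⟨√n ^ 2 / (2 * a) + B * T + φ (0, 0), fun x t ht => ?_⟩
  have ht0 : 0 < t := ha.trans_le ht.1
  have hB := hP.bound_nonneg (ht0.le.trans ht.2)
  obtain ⟨z, hz⟩ := exists_latticeVector_norm_add_le x
  rw [← hφ.periodic z x t ⟨ht0.le, ht.2⟩]
  refine (hφ.le_minimalAction_add le_rfl ht0 ht.2 0 _).trans ?_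
  grw [hP.minimalAction_le le_rfl ht0 ht.2, sub_zero, sub_zero, hz, ← ht.1, ht.2]

lemma exists_forall_ge (hφ : IsForwardSolution T P φ) (hP : IsLipschitzPressure T B L P)
    (hT : 0 < T) : ∃ m, ∀ x, ∀ t ∈ Ioc 0 T, m ≤ φ (x, t) := by
  have hB := hP.bound_nonneg hT.le
  have hinitial : ∀ y, φ (0, T) - (√n ^ 2 / (2 * T) + B * T) ≤ φ (y, 0) := fun y => by
    obtain ⟨z, hz⟩ := exists_latticeVector_norm_add_le y
    rw [← hφ.periodic z y 0 ⟨le_rfl, hT.le⟩, sub_le_iff_le_add']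
    refine (hφ.le_minimalAction_add le_rfl hT le_rfl (y + latticeVector z) 0).trans ?_
    grw [hP.minimalAction_le le_rfl hT le_rfl, sub_zero, zero_sub, norm_neg, hz]
  refine ⟨φ (0, T) - (√n ^ 2 / (2 * T) + B * T) - B * T, fun x t ht => ?_⟩
  refine le_of_forall_pos_le_add fun ε hε => ?_
  obtain ⟨y, hy⟩ := hφ.exists_minimalAction_add_lt le_rfl ht.1 ht.2 x hε
  have hJ := hP.le_minimalAction (x := x) (y := y) le_rfl ht.1 ht.2
  have hkin : 0 ≤ ‖x - y‖ ^ 2 / (2 * (t - 0)) := div_nonneg (sq_nonneg _) (by linarith [ht.1])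
  have hBt : B * (t - 0) ≤ B * T := by
    gcongr
    linarith [ht.2]
  linarith [hinitial y]

lemma exists_forall_abs_le (hφ : IsForwardSolution T P φ) (hP : IsLipschitzPressure T B L P)
    (ha : 0 < a) (hT : 0 < T) : ∃ M : ℝ≥0, ∀ x, ∀ t ∈ Icc a T, |φ (x, t)| ≤ M := by
  obtain ⟨M, hM⟩ := hφ.exists_forall_le hP ha
  obtain ⟨m, hm⟩ := hφ.exists_forall_ge hP hT
  refine ⟨(max M (-m)).toNNReal, fun x t ht => le_trans ?_ (Real.le_coe_toNNReal _)⟩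
  rw [abs_le']
  exact ⟨le_max_of_le_left (hM x t ht),
    le_max_of_le_right (neg_le_neg (hm x t ⟨ha.trans_le ht.1, ht.2⟩))⟩

lemma exists_add_le (hφ : IsForwardSolution T P φ) (hP : IsLipschitzPressure T B L P) {R : ℝ}
    (hR : 0 ≤ R) :
    ∃ C, 0 ≤ C ∧ ∀ (x y : Space n) (s t ε : ℝ) (z : Space n × ℝ), 0 ≤ s → s < t → t ≤ T →
      t - s ≤ 1 → ‖(t - s)⁻¹ • (x - y)‖ ≤ R →
      minimalAction P y x s t + φ (y, s) ≤ φ (x, t) + ε → |z.2| ≤ (t - s) / 2 → t + z.2 ≤ T →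
      φ (x + z.1, t + z.2) ≤ φ (x, t) + hjCovector P (x, t) ((t - s)⁻¹ • (x - y)) z +
        C * ((t - s) * ‖z‖ + ‖z‖ ^ 2 / (t - s)) + ε := by
  obtain ⟨C, hC, hvar⟩ := hP.exists_minimalAction_add_le hR
  refine ⟨C, hC, fun x y s t ε z hs hst ht hδ hv hy hz hzT => ?_⟩
  have hst' : s < t + z.2 := by linarith [neg_le_of_abs_le hz]
  linarith [hφ.le_minimalAction_add hs hst' hzT y (x + z.1), hvar x y s t z hs hst ht hδ hv hz hzT]

/-- Nearly optimal starting points at a fixed distance in time have bounded velocity because `φ`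
is bounded, and moving the end point then changes the minimal action at most linearly. -/
lemma exists_le_add_mul_dist (hφ : IsForwardSolution T P φ) (hP : IsLipschitzPressure T B L P)
    (ha : 0 < a) (hT : 0 < T) :
    ∃ K : ℝ≥0, ∀ t ∈ Icc a T, ∀ x x', dist x x' ≤ 1 →
      φ (x', t) ≤ φ (x, t) + K * dist x x' := by
  obtain ⟨M, hM⟩ := hφ.exists_forall_abs_le hP (half_pos ha) hT
  set δ : ℝ := min (a / 2) 1
  have hδ0 : 0 < δ := lt_min (half_pos ha) one_pos
  have hδa : δ ≤ a / 2 := min_le_left _ _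
  set R : ℝ := √((2 * M + 1 + B * δ) * (2 * δ)) / δ
  obtain ⟨C, hC, hvar⟩ := hφ.exists_add_le hP (R := R) (by positivity)
  refine ⟨.mk (R + C * (δ + 1 / δ)) (by positivity), fun t ht x x' hx => ?_⟩
  rw [NNReal.coe_mk]
  have hs0 : 0 ≤ t - δ := by linarith [ht.1]
  have hst : t - δ < t := by linarith
  refine le_of_forall_pos_le_add fun ε hε => ?_
  obtain ⟨y, hy⟩ := hφ.exists_minimalAction_add_lt hs0 hst ht.2 x (lt_min hε one_pos)
  have hv : ‖(t - (t - δ))⁻¹ • (x - y)‖ ≤ R := by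
    have hA : minimalAction P y x (t - δ) t ≤ 2 * M + 1 := by
      linarith [min_le_right ε 1, le_of_abs_le (hM x t ⟨by linarith [ht.1], ht.2⟩),
        neg_le_of_abs_le (hM y (t - δ) ⟨by linarith [ht.1], by linarith [ht.2]⟩)]
    simpa only [sub_sub_cancel] using hP.norm_velocity_le hs0 hst ht.2 hA
  have h := hvar x y (t - δ) t (min ε 1) (x' - x, 0) hs0 hst ht.2
    (by rw [sub_sub_cancel]; exact min_le_right _ _) hv hy.le
    (by rw [sub_sub_cancel, abs_zero]; positivity) (by simpa using ht.2)
  rw [sub_sub_cancel] at h hv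
  have hz : ‖((x' - x, 0) : Space n × ℝ)‖ = dist x x' := by simp [dist_eq_norm']
  have hinner := (real_inner_le_norm (δ⁻¹ • (x - y)) (x' - x)).trans
    (mul_le_mul_of_nonneg_right hv (norm_nonneg _))
  have hsq : C * (dist x x' ^ 2 / δ) ≤ C * (1 / δ * dist x x') := by
    rw [div_mul_eq_mul_div, one_mul]
    gcongr
    exact pow_le_of_le_one dist_nonneg hx two_ne_zero
  rw [hjCovector_apply, hz, add_sub_cancel, add_zero, mul_zero, add_zero] at h
  rw [← dist_eq_norm'] at hinner
  linarith [min_le_left ε 1]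

lemma exists_lipschitzWith (hφ : IsForwardSolution T P φ) (hP : IsLipschitzPressure T B L P)
    (ha : 0 < a) (hT : 0 < T) :
    ∃ K : ℝ≥0, ∀ t ∈ Icc a T, LipschitzWith K fun x => φ (x, t) := by
  obtain ⟨M, hM⟩ := hφ.exists_forall_abs_le hP ha hT
  obtain ⟨K, hK⟩ := hφ.exists_le_add_mul_dist hP ha hT
  refine ⟨K + 2 * M, fun t ht => lipschitzOnWith_univ.1 <|
    lipschitzOnWith_of_abs_le_of_dist_le_one (fun x _ => hM x t ht) fun x _ x' _ hx => ?_⟩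
  have h := hK t ht x' x (by rwa [dist_comm])
  rw [dist_comm] at h
  rw [Real.dist_eq, abs_le]
  constructor <;> linarith [hK t ht x x' hx]

lemma norm_velocity_le (hφ : IsForwardSolution T P φ) (hP : IsLipschitzPressure T B L P)
    (hs : 0 ≤ s) (hst : s < t) (ht : t ≤ T) (hK : LipschitzWith K fun x => φ (x, s))
    (hy : minimalAction P y x s t + φ (y, s) ≤ φ (x, t) + (t - s)) :
    ‖(t - s)⁻¹ • (x - y)‖ ≤ 2 * K + 4 * B + 3 := by
  have h0 : 0 < t - s := sub_pos.2 hst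
  have hB := hP.bound_nonneg (hs.trans (hst.le.trans ht))
  set u : Space n := (t - s)⁻¹ • (x - y)
  have hxy : ‖x - y‖ = (t - s) * ‖u‖ := by
    rw [norm_smul, norm_inv, Real.norm_of_nonneg h0.le, mul_inv_cancel_left₀ h0.ne']
  have hlow := hP.le_minimalAction (x := x) (y := y) hs hst ht
  have hup := hP.minimalAction_le (x := x) (y := x) hs hst ht
  have hLip : φ (x, s) - φ (y, s) ≤ K * ((t - s) * ‖u‖) := by
    rw [← hxy, ← dist_eq_norm]
    exact (le_abs_self _).trans (hK.dist_le_mul x y)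
  have hkin : ((t - s) * ‖u‖) ^ 2 / (2 * (t - s)) = (t - s) * (‖u‖ ^ 2 / 2) := by
    field_simp
  rw [hxy, hkin] at hlow
  rw [sub_self, norm_zero, zero_pow two_ne_zero, zero_div, zero_add] at hup
  have hspeed : ‖u‖ ^ 2 / 2 ≤ K * ‖u‖ + 2 * B + 1 := by
    refine le_of_mul_le_mul_left ?_ h0
    linarith [hφ.le_minimalAction_add hs hst ht x x]
  by_contra! hu
  nlinarith [K.coe_nonneg]

/-- The superdifferential is obtained as a limit of the velocities of nearly minimal curves ending
at `p`, over shorter and shorter time intervals. -/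
lemma exists_hasSuperderivAt (hφ : IsForwardSolution T P φ) (hP : IsLipschitzPressure T B L P)
    (hp : p.2 ∈ Ioo 0 T) : ∃ v, HasSuperderivAt φ (hjCovector P p v) p := by
  obtain ⟨K, hK⟩ := hφ.exists_lipschitzWith hP (half_pos hp.1) (hp.1.trans hp.2)
  have hB := hP.bound_nonneg (hp.1.trans hp.2).le
  obtain ⟨C, hC, hvar⟩ := hφ.exists_add_le hP (R := 2 * K + 4 * B + 3) (by positivity)
  have hcompact := (isCompact_closedBall (0 : Space n) (2 * K + 4 * B + 3)).image
    (continuous_hjCovector P p)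
  suffices h : ∃ ℓ ∈ hjCovector P p '' Metric.closedBall 0 (2 * K + 4 * B + 3),
      HasSuperderivAt φ ℓ p by
    obtain ⟨_, ⟨v, -, rfl⟩, hv⟩ := h
    exact ⟨v, hv⟩
  refine HamiltonJacobi.exists_hasSuperderivAt hcompact fun η hη => ?_
  obtain ⟨δ, hδ0, hδ⟩ := exists_between (lt_min (half_pos hp.1)
    (lt_min one_pos (show 0 < η / (2 * (C + 1)) by positivity)))
  obtain ⟨hδp, hδ1, hδη⟩ := by simpa only [lt_min_iff] using hδ
  obtain ⟨ρ, hρ0, hρ⟩ := exists_between (lt_min (half_pos hδ0) (lt_min (sub_pos.2 hp.2)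
    (show 0 < η * δ / (2 * (C + 1)) by positivity)))
  obtain ⟨hρδ, hρT, hρη⟩ := by simpa only [lt_min_iff] using hρ
  rw [lt_div_iff₀ (by positivity)] at hδη hρη
  have hs0 : 0 ≤ p.2 - δ := by linarith [hp.1]
  have hst : p.2 - δ < p.2 := by linarith
  refine ⟨ρ, hρ0, fun ε hε => ?_⟩
  obtain ⟨y, hy⟩ := hφ.exists_minimalAction_add_lt hs0 hst hp.2.le p.1 (lt_min hε hδ0)
  have hy' : minimalAction P y p.1 (p.2 - δ) p.2 + φ (y, p.2 - δ) ≤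
      φ (p.1, p.2) + (p.2 - (p.2 - δ)) := by
    linarith [min_le_right ε δ]
  have hspeed := hφ.norm_velocity_le hP hs0 hst hp.2.le
    (hK _ ⟨by linarith, by linarith [hp.2]⟩) hy'
  refine ⟨_, ⟨_, mem_closedBall_zero_iff.2 hspeed, rfl⟩, fun z hz => ?_⟩
  have hz2 : |z.2| ≤ ρ := (norm_snd_le z).trans hz
  have h := hvar p.1 y (p.2 - δ) p.2 ε z hs0 hst hp.2.le (by linarith) hspeed
    (hy.le.trans (by gcongr; exact min_le_left _ _)) (by linarith)
    (by linarith [le_of_abs_le hz2])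
  have herror : C * (δ * ‖z‖ + ‖z‖ ^ 2 / δ) ≤ η * ‖z‖ := by
    have hCδ : C * δ ≤ η / 2 := by linarith
    have hCρ : C * (‖z‖ / δ) ≤ η / 2 := by
      rw [← mul_div_assoc, div_le_iff₀ hδ0]
      nlinarith
    calc C * (δ * ‖z‖ + ‖z‖ ^ 2 / δ) = (C * δ + C * (‖z‖ / δ)) * ‖z‖ := by ring
      _ ≤ η * ‖z‖ := by gcongr; linarith [hCδ, hCρ]
  rw [sub_sub_cancel] at h ⊢
  exact h.trans (by gcongr)

lemma strongConcaveOn (hφ : IsForwardSolution T P φ) (hP : IsLipschitzPressure T B L P)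
    (hs : 0 ≤ s) (hst : s < t) (ht : t ≤ T) {κ : ℝ → ℝ} (hκ : IntervalIntegrable κ volume s t)
    (hκ0 : ∀ τ ∈ Icc s t, 0 ≤ κ τ)
    (hPκ : ∀ τ ∈ Icc s t, StrongConcaveOn univ (-κ τ) fun x => P (x, τ)) :
    StrongConcaveOn univ (-(1 / (t - s) + ∫ τ in s..t, κ τ)) fun x => φ (x, t) := by
  refine strongConcaveOn_of_isGLB (fun y => ?_) fun x => hφ.isGLB x s ⟨hs, hst.le.trans ht⟩ t
    ⟨hs.trans hst.le, ht⟩ hst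
  have hadd := (hP.strongConcaveOn_minimalAction hs hst ht hκ hκ0 hPκ y).add
    (uniformConcaveOn_zero.2 (concaveOn_const (φ (y, s)) convex_univ))
  rwa [add_zero] at hadd

lemma exists_strongConcaveOn (hφ : IsForwardSolution T P φ) (hP : IsLipschitzPressure T B L P)
    (hsc : IsSemiconcavePressure T P) (ha : 0 < a) (hb : b < T) :
    ∃ k, ∀ t ∈ Icc a b, StrongConcaveOn univ (-k) fun x => φ (x, t) := by
  obtain ⟨C, hCint, hC⟩ := hsc
  have hPC : ∀ τ ∈ Ioo 0 T, StrongConcaveOn univ (-(2 * C τ)) fun x => P (x, τ) := fun τ hτ =>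
    strongConcaveOn_iff_convex.2 ((hC τ hτ).2.congr fun x _ => by ring)
  refine ⟨2 / a + ∫ τ in a / 2..b, 2 * C τ, fun t ht => ?_⟩
  have hst : a / 2 < t := by linarith [ht.1]
  have hsub : ∀ {c}, c < T → Icc (a / 2) c ⊆ Ioo 0 T := fun hc τ hτ =>
    ⟨by linarith [hτ.1], hτ.2.trans_lt hc⟩
  have hint : ∀ {c}, a / 2 ≤ c → c < T →
      IntervalIntegrable (fun τ => 2 * C τ) volume (a / 2) c := fun hac hc =>
    ((intervalIntegrable_iff_integrableOn_Icc_of_le hac).2 <|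
      hCint.integrableOn_compact_subset (hsub hc) isCompact_Icc).const_mul 2
  have htT : t < T := ht.2.trans_lt hb
  have hφt := hφ.strongConcaveOn hP (by linarith) hst htT.le (hint hst.le htT)
    (fun τ hτ => by linarith [(hC τ (hsub htT hτ)).1]) fun τ hτ => hPC τ (hsub htT hτ)
  refine hφt.mono (neg_le_neg (add_le_add ?_ ?_))
  · rw [div_le_div_iff₀ (by linarith) ha]
    linarith [ht.1]
  · refine intervalIntegral.integral_mono_interval le_rfl hst.le ht.2 ?_
      (hint (hst.le.trans ht.2) hb)
    filter_upwards [ae_restrict_mem measurableSet_Ioc] with τ hτ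
    have hCτ := (hC τ (hsub hb (Ioc_subset_Icc_self hτ))).1
    rw [Pi.zero_apply]
    positivity

end IsForwardSolution

end ForwardSolution

section TimeReversal

variable {n : ℕ} {T B a b : ℝ} {L : ℝ≥0} {P φ : Space n × ℝ → ℝ} {u : Space n} {p : Space n × ℝ}

/-- The time reversal of a function on `ℝⁿ × [0,T]`. It interchanges forward and backward
solutions, up to the sign of the solution. -/
def reverse (T : ℝ) (f : Space n × ℝ → ℝ) (p : Space n × ℝ) : ℝ :=
  f (p.1, T - p.2)

lemma minimalAction_reverse (P : Space n × ℝ → ℝ) (x y : Space n) (s t : ℝ) :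
    minimalAction (reverse T P) y x s t = minimalAction P x y (T - t) (T - s) := by
  have haction : ∀ γ : ℝ → Space n, orbitAction (reverse T P) s t (fun τ => γ (T - τ)) =
      orbitAction P (T - t) (T - s) γ := fun γ => by
    unfold orbitAction reverse
    rw [← intervalIntegral.integral_comp_sub_left (fun τ => ‖deriv γ τ‖ ^ 2 / 2 + P (γ τ, τ)) T]
    simp only [deriv_comp_const_sub, norm_neg]
  unfold minimalAction
  congr 1
  ext A
  constructor
  · rintro ⟨γ, hγ, hs, ht, rfl⟩
    refine ⟨fun τ => γ (T - τ), by fun_prop, by simpa using ht, by simpa using hs, ?_⟩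
    simpa using haction fun τ => γ (T - τ)
  · rintro ⟨γ, hγ, hs, ht, rfl⟩
    exact ⟨fun τ => γ (T - τ), by fun_prop, ht, hs, (haction γ).symm⟩

lemma IsLipschitzPressure.reverse (hP : IsLipschitzPressure T B L P) :
    IsLipschitzPressure T B L (reverse T P) where
  bound x t ht := hP.bound x (T - t) (sub_mem_Icc_zero_iff_right.2 ht)
  lipschitz := by
    have hflip : LipschitzWith 1 fun p : Space n × ℝ => (p.1, T - p.2) := by
      refine LipschitzWith.of_dist_le_mul fun p q => ?_
      rw [Prod.dist_eq, Prod.dist_eq, dist_sub_left, NNReal.coe_one, one_mul]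
    have hmaps : MapsTo (fun p : Space n × ℝ => (p.1, T - p.2)) (univ ×ˢ Icc 0 T)
        (univ ×ˢ Icc 0 T) := fun p hp => ⟨mem_univ _, sub_mem_Icc_zero_iff_right.2 hp.2⟩
    have hcomp := hP.lipschitz.comp hflip.lipschitzOnWith hmaps
    rwa [mul_one] at hcomp

lemma IsSemiconcavePressure.reverse (hsc : IsSemiconcavePressure T P) :
    IsSemiconcavePressure T (reverse T P) := by
  obtain ⟨C, hCint, hC⟩ := hsc
  refine ⟨fun t => C (T - t), ?_, fun t ht => hC (T - t) (sub_mem_Ioo_zero_iff_right.2 ht)⟩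
  rw [locallyIntegrableOn_iff isOpen_Ioo.isLocallyClosed] at hCint ⊢
  refine fun S hS hScompact => ?_
  refine ((Measure.measurePreserving_sub_left volume T).integrableOn_image
    (MeasurableEquiv.subLeft T).measurableEmbedding).1
    (hCint _ ?_ (hScompact.image (continuous_sub_left T)))
  rintro _ ⟨t, ht, rfl⟩
  exact sub_mem_Ioo_zero_iff_right.2 (hS ht)

lemma HasSuperderivAt.of_neg_reverse (h : HasSuperderivAt (-reverse T φ)
    (hjCovector (reverse T P) (p.1, T - p.2) u) (p.1, T - p.2)) :
    HasSuperderivAt (-φ) (-hjCovector P p (-u)) p := by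
  intro η hη
  have hflip : Tendsto (fun z : Space n × ℝ => (z.1, -z.2)) (𝓝 0) (𝓝 0) := by
    have hcont : Continuous fun z : Space n × ℝ => (z.1, -z.2) := by fun_prop
    simpa [← Prod.zero_eq_mk] using hcont.tendsto 0
  filter_upwards [hflip.eventually (h η hη)] with z hz
  have hnorm : ‖(z.1, -z.2)‖ = ‖z‖ := by simp [Prod.norm_def]
  rw [hnorm] at hz
  have htime : T - (T - p.2 + -z.2) = p.2 + z.2 := by ring
  simp only [Pi.neg_apply, HamiltonJacobi.reverse, Prod.mk_add_mk, hjCovector_apply, htime,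
    sub_sub_cancel] at hz
  rw [Pi.neg_apply, Pi.neg_apply, neg_apply, hjCovector_apply, inner_neg_left, norm_neg]
  change -φ (p.1 + z.1, p.2 + z.2) ≤ _
  linarith

namespace IsBackwardSolution

lemma isForwardSolution_neg_reverse (hφ : IsBackwardSolution T P φ) :
    IsForwardSolution T (reverse T P) (-reverse T φ) where
  periodic z x t ht := neg_inj.2 (hφ.periodic z x _ (sub_mem_Icc_zero_iff_right.2 ht))
  isGLB x s hs t ht hst := by
    have hlub := (hφ.isLUB x _ (sub_mem_Icc_zero_iff_right.2 ht) _
      (sub_mem_Icc_zero_iff_right.2 hs) (sub_lt_sub_left hst T)).neg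
    rw [← image_neg_eq_neg, ← range_comp] at hlub
    simpa only [Function.comp_def, neg_add, neg_neg, minimalAction_reverse, Pi.neg_apply,
      HamiltonJacobi.reverse] using hlub

lemma exists_hasSuperderivAt_neg (hφ : IsBackwardSolution T P φ)
    (hP : IsLipschitzPressure T B L P) (hp : p.2 ∈ Ioo 0 T) :
    ∃ v, HasSuperderivAt (-φ) (-hjCovector P p v) p := by
  obtain ⟨u, hu⟩ := hφ.isForwardSolution_neg_reverse.exists_hasSuperderivAt hP.reverse
    (p := (p.1, T - p.2)) (sub_mem_Ioo_zero_iff_right.2 hp)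
  exact ⟨-u, hu.of_neg_reverse⟩

lemma exists_strongConcaveOn_neg (hφ : IsBackwardSolution T P φ)
    (hP : IsLipschitzPressure T B L P) (hsc : IsSemiconcavePressure T P) (ha : 0 < a)
    (hb : b < T) : ∃ k, ∀ t ∈ Icc a b, StrongConcaveOn univ (-k) fun x => -φ (x, t) := by
  obtain ⟨k, hk⟩ := hφ.isForwardSolution_neg_reverse.exists_strongConcaveOn hP.reverse hsc.reverse
    (sub_pos.2 hb) (sub_lt_self T ha)
  refine ⟨k, fun t ht => ?_⟩
  simpa only [Pi.neg_apply, HamiltonJacobi.reverse, sub_sub_cancel] using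
    hk (T - t) ⟨sub_le_sub_left ht.2 T, sub_le_sub_left ht.1 T⟩

end IsBackwardSolution

end TimeReversal

section ReversiblePair

variable {n : ℕ} {T B : ℝ} {L : ℝ≥0} {P φ φf φb : Space n × ℝ → ℝ} {v : Space n}
  {p : Space n × ℝ}

lemma hasFDerivAt_slice (h : HasFDerivAt φ (hjCovector P p v) p) :
    HasFDerivAt (fun x => φ (x, p.2)) (innerSL ℝ v) p.1 := by
  have hcomp := HasFDerivAt.comp (g := φ) p.1 h (hasFDerivAt_prodMk_left (𝕜 := ℝ) p.1 p.2)
  have hℓ : (hjCovector P p v).comp (ContinuousLinearMap.inl ℝ (Space n) ℝ) = innerSL ℝ v := by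
    ext ξ
    simp
  rwa [hℓ] at hcomp

lemma fullGradient_of_hasFDerivAt (h : HasFDerivAt φ (hjCovector P p v) p) :
    fullGradient φ p = (v, P p - ‖v‖ ^ 2 / 2) := by
  have hspace : HasGradientAt (fun x => φ (x, p.2)) v p.1 :=
    hasGradientAt_iff_hasFDerivAt.2 (hasFDerivAt_slice h)
  have htime : HasDerivAt (fun t => φ (p.1, t)) (P p - ‖v‖ ^ 2 / 2) p.2 := by
    simpa [Function.comp_def] using
      (HasFDerivAt.comp (g := φ) p.2 h (hasFDerivAt_prodMk_right (𝕜 := ℝ) p.1 p.2)).hasDerivAt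
  rw [fullGradient, spaceGradient, timeDerivative, hspace.gradient, htime.deriv]

lemma satisfiesHJAt_of_hasFDerivAt (h : HasFDerivAt φ (hjCovector P p v) p) :
    SatisfiesHJAt P φ p := by
  obtain ⟨hspace, htime⟩ := Prod.ext_iff.1 (fullGradient_of_hasFDerivAt h)
  change spaceGradient φ p = v at hspace
  change timeDerivative φ p = P p - ‖v‖ ^ 2 / 2 at htime
  rw [SatisfiesHJAt, hspace, htime, sub_add_cancel]

namespace IsReversiblePair

lemma le (hφ : IsReversiblePair T P φf φb) (hp : p.2 ∈ Icc 0 T) : φb p ≤ φf p := by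
  obtain ⟨x, t⟩ := p
  have hT : T ∈ Icc 0 T := ⟨hp.1.trans hp.2, le_rfl⟩
  rcases hp.2.eq_or_lt with rfl | htT
  · exact (hφ.final x).ge
  refine (hφ.backward.isLUB x t hp T hT htT).2 ?_
  rintro _ ⟨y, rfl⟩
  dsimp only
  linarith [hφ.forward.le_minimalAction_add hp.1 htT le_rfl x y, hφ.final y]

lemma hasFDerivAt (hφ : IsReversiblePair T P φf φb) (hP : IsLipschitzPressure T B L P)
    (hp : p ∈ reversibilitySet T φf φb) :
    HasFDerivAt φf (hjCovector P p (spaceGradient φf p)) p ∧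
      HasFDerivAt φb (hjCovector P p (spaceGradient φf p)) p := by
  obtain ⟨v, hv⟩ := hφ.forward.exists_hasSuperderivAt hP hp.1
  obtain ⟨w, hw⟩ := hφ.backward.exists_hasSuperderivAt_neg hP hp.1
  have hle : ∀ᶠ z in 𝓝 0, φb (p + z) ≤ φf (p + z) := by
    have htime : Tendsto (fun z : Space n × ℝ => (p + z).2) (𝓝 0) (𝓝 p.2) :=
      (continuous_snd.comp (continuous_const.add continuous_id)).tendsto' _ _ (by simp)
    filter_upwards [htime.eventually (Icc_mem_nhds hp.1.1 hp.1.2)] with z hz using hφ.le hz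
  have hderiv : HasFDerivAt φf (hjCovector P p v) p ∧ HasFDerivAt φb (hjCovector P p v) p :=
    hv.hasFDerivAt_of_le (hv.eq_of_le hw hle hp.2 ▸ hw) hle hp.2
  rwa [show spaceGradient φf p = v from
    congrArg Prod.fst (fullGradient_of_hasFDerivAt hderiv.1)]

end IsReversiblePair

end ReversiblePair

section LipschitzGradient

variable {n : ℕ} {T B k R : ℝ} {L : ℝ≥0} {P φ : Space n × ℝ → ℝ} {v : Space n}
  {p z : Space n × ℝ}

lemma norm_sub_smul_le (hv : ‖v‖ ≤ R) : ‖z.1 - z.2 • v‖ ≤ (1 + R) * ‖z‖ := by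
  grw [norm_sub_le, norm_smul, norm_fst_le z, norm_snd_le z, hv]
  linarith

lemma norm_smul_sq_div (c : ℝ) (v : Space n) : ‖c • v‖ ^ 2 / (2 * c) = c * (‖v‖ ^ 2 / 2) := by
  rw [norm_smul, mul_pow, Real.norm_eq_abs, sq_abs]
  rcases eq_or_ne c 0 with rfl | hc
  · simp
  · field_simp

/-- Follow the straight curve with velocity `v` back to time `p.2`. -/
lemma IsForwardSolution.le_add_hjCovector (hφ : IsForwardSolution T P φ)
    (hP : IsLipschitzPressure T B L P) (hp : 0 ≤ p.2) (hz : 0 ≤ z.2) (hzT : p.2 + z.2 ≤ T)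
    (hk : 0 ≤ k) (hv : ‖v‖ ≤ R)
    (hq : ∀ ξ, φ (p.1 + ξ, p.2) ≤ φ p + inner ℝ v ξ + k * ‖ξ‖ ^ 2) :
    φ (p + z) ≤ φ p + hjCovector P p v z + (k * (1 + R) ^ 2 + L * (1 + R)) * ‖z‖ ^ 2 := by
  have hR := (norm_nonneg v).trans hv
  have hshift := norm_sub_smul_le (z := z) hv
  have hstart := hq (z.1 - z.2 • v)
  grw [hshift] at hstart
  rw [inner_sub_right, real_inner_smul_right, real_inner_self_eq_norm_sq] at hstart
  rw [hjCovector_apply]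
  change φ (p.1 + z.1, p.2 + z.2) ≤ _
  rcases hz.eq_or_lt with hz0 | hz0
  · have hpos : 0 ≤ L * (1 + R) * ‖z‖ ^ 2 := by positivity
    simp only [← hz0, zero_smul, sub_zero, zero_mul, mul_zero, add_zero] at hstart ⊢
    linarith
  have hz2 : z.2 ≤ ‖z‖ := (le_abs_self _).trans (norm_snd_le z)
  have hradius : ‖z‖ ≤ (1 + R) * ‖z‖ := le_mul_of_one_le_left (norm_nonneg z) (by linarith)
  have haction := hP.minimalAction_le_of_mem_closedBall (r := (1 + R) * ‖z‖) (p := p)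
    (y := p.1 + (z.1 - z.2 • v)) (x := p.1 + z.1) hp (lt_add_of_pos_right _ hz0) hzT
    ⟨hp, by linarith⟩ (by simpa [Prod.dist_eq] using hshift)
    (show p + z ∈ Metric.closedBall p _ by simpa using hradius)
  have hvel : p.1 + z.1 - (p.1 + (z.1 - z.2 • v)) = z.2 • v := by module
  rw [hvel, add_sub_cancel_left, norm_smul_sq_div] at haction
  have hpressure : z.2 * (L * ((1 + R) * ‖z‖)) ≤ L * (1 + R) * ‖z‖ ^ 2 := by
    grw [hz2]
    linarith
  linarith [hφ.le_minimalAction_add hp (lt_add_of_pos_right _ hz0) hzT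
    (p.1 + (z.1 - z.2 • v)) (p.1 + z.1)]

/-- The errors of the lower estimate at a point reached after the time `h`, where `d` is the
distance to the base point and `q` the deviation of the velocity. -/
lemma quadratic_error_le {k L R d h q : ℝ} (hk : 0 ≤ k) (hL : 0 ≤ L) (hR : 0 ≤ R) (hh : 0 ≤ h)
    (hd : h ≤ d) (hsmall : h * (4 * k + 2 * L + 1) ≤ 1) :
    k * ((1 + R) * d + h * q) ^ 2 + h * (L * ((1 + R) * d + h * q)) + L ^ 2 * h ^ 3 ≤
      (2 * k * (1 + R) ^ 2 + L * (2 + R) + L ^ 2) * d ^ 2 + h * (q ^ 2 / 2) := by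
  have hd0 := hh.trans hd
  have hh1 : h ≤ 1 := by nlinarith [mul_nonneg hh hk, mul_nonneg hh hL]
  have hsquare : k * ((1 + R) * d + h * q) ^ 2 ≤ k * (2 * ((1 + R) * d) ^ 2 + 2 * (h * q) ^ 2) := by
    gcongr
    linarith [sq_nonneg ((1 + R) * d - h * q)]
  have hlinear : h * (L * ((1 + R) * d + h * q)) ≤ L * (2 + R) * d ^ 2 + L * h ^ 2 * q ^ 2 := by
    have hhq : L * h ^ 2 * q ≤ L * h ^ 2 * (1 + q ^ 2) := by
      gcongr
      linarith [sq_nonneg (q - 1 / 2)]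
    have hhd : L * (1 + R) * (h * d) + L * h ^ 2 ≤ L * (1 + R) * (d * d) + L * d ^ 2 := by gcongr
    linarith
  have hcubic : L ^ 2 * h ^ 3 ≤ L ^ 2 * d ^ 2 := by
    calc L ^ 2 * h ^ 3 = L ^ 2 * (h ^ 2 * h) := by ring
      _ ≤ L ^ 2 * (d ^ 2 * 1) := by gcongr
      _ = L ^ 2 * d ^ 2 := by ring
  have habsorb : h * q ^ 2 * (h * (4 * k + 2 * L)) ≤ h * q ^ 2 * 1 := by
    gcongr
    linarith
  linarith

/-- The velocity of a nearly minimal curve deviates from `v` by some `q`; its cost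
`z.2 * ‖q‖ ^ 2 / 2` absorbs all errors that involve `q`. -/
lemma IsForwardSolution.add_hjCovector_le (hφ : IsForwardSolution T P φ)
    (hP : IsLipschitzPressure T B L P) (hp : 0 ≤ p.2) (hz : 0 ≤ z.2) (hzT : p.2 + z.2 ≤ T)
    (hk : 0 ≤ k) (hv : ‖v‖ ≤ R) (hsmall : z.2 * (4 * k + 2 * L + 1) ≤ 1)
    (hq : ∀ ξ, φ p + inner ℝ v ξ - k * ‖ξ‖ ^ 2 ≤ φ (p.1 + ξ, p.2)) :
    φ p + hjCovector P p v z - (2 * k * (1 + R) ^ 2 + L * (2 + R) + L ^ 2) * ‖z‖ ^ 2 ≤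
      φ (p + z) := by
  have hR := (norm_nonneg v).trans hv
  have hshift := norm_sub_smul_le (z := z) hv
  rw [hjCovector_apply]
  change _ ≤ φ (p.1 + z.1, p.2 + z.2)
  rcases hz.eq_or_lt with hz0 | hz0
  · have hstart := hq (z.1 - z.2 • v)
    grw [hshift] at hstart
    have hpos : 0 ≤ (k * (1 + R) ^ 2 + L * (2 + R) + L ^ 2) * ‖z‖ ^ 2 := by positivity
    simp only [← hz0, zero_smul, sub_zero, mul_zero, add_zero] at hstart ⊢
    linarith
  have hst : p.2 < p.2 + z.2 := lt_add_of_pos_right _ hz0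
  refine le_of_forall_pos_le_add fun ε hε => ?_
  obtain ⟨y, hy⟩ := hφ.exists_minimalAction_add_lt hp hst hzT (p.1 + z.1) hε
  obtain ⟨q, rfl⟩ : ∃ q, y = p.1 + (z.1 - z.2 • v - z.2 • q) :=
    ⟨z.2⁻¹ • (p.1 + z.1 - z.2 • v - y), by rw [smul_inv_smul₀ hz0.ne']; module⟩
  have hz2 : z.2 ≤ ‖z‖ := (le_abs_self _).trans (norm_snd_le z)
  have hy0 : ‖z.1 - z.2 • v - z.2 • q‖ ≤ (1 + R) * ‖z‖ + z.2 * ‖q‖ := by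
    grw [norm_sub_le, hshift, norm_smul, Real.norm_of_nonneg hz]
  have hradius : ‖z‖ ≤ (1 + R) * ‖z‖ + z.2 * ‖q‖ := by
    linarith [mul_nonneg hR (norm_nonneg z), mul_nonneg hz (norm_nonneg q)]
  have haction := hP.le_minimalAction_of_mem_closedBall (r := (1 + R) * ‖z‖ + z.2 * ‖q‖) (p := p)
    (y := p.1 + (z.1 - z.2 • v - z.2 • q)) (x := p.1 + z.1) hp hst hzT
    ⟨hp, by linarith⟩ (by simpa [Prod.dist_eq] using hy0)
    (show p + z ∈ Metric.closedBall p _ by simpa using hradius)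
  have hvel : p.1 + z.1 - (p.1 + (z.1 - z.2 • v - z.2 • q)) = z.2 • (v + q) := by module
  rw [hvel, add_sub_cancel_left, norm_smul_sq_div, norm_add_sq_real] at haction
  have hstart := hq (z.1 - z.2 • v - z.2 • q)
  grw [hy0] at hstart
  rw [inner_sub_right, inner_sub_right, real_inner_smul_right, real_inner_smul_right,
    real_inner_self_eq_norm_sq] at hstart
  have herror := quadratic_error_le hk L.coe_nonneg hR hz hz2 hsmall (q := ‖q‖)
  linarith

end LipschitzGradient

section LocallyLipschitz

variable {n : ℕ} {T B a b : ℝ} {L : ℝ≥0} {P φf φb : Space n × ℝ → ℝ}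

lemma norm_le_of_forall_inner_le {E : Type*} [NormedAddCommGroup E] [InnerProductSpace ℝ E]
    {u : E} {r K : ℝ} (hr : 0 < r) (h : ∀ w, ‖w‖ ≤ r → inner ℝ u w ≤ K * r) : ‖u‖ ≤ K := by
  rcases eq_or_ne u 0 with rfl | hu
  · have hK := h 0 (by simpa using hr.le)
    rw [inner_zero_left] at hK
    rw [norm_zero]
    exact nonneg_of_mul_nonneg_left hK hr
  have hu0 : 0 < ‖u‖ := norm_pos_iff.2 hu
  have hw := h ((r / ‖u‖) • u) (by
    rw [norm_smul, Real.norm_of_nonneg (by positivity), div_mul_cancel₀ _ hu0.ne'])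
  rw [real_inner_smul_right, real_inner_self_eq_norm_sq] at hw
  refine le_of_mul_le_mul_right (hw.trans' (le_of_eq ?_)) hr
  field_simp

lemma locallyLipschitzOn_congr {X Y : Type*} [PseudoEMetricSpace X] [PseudoEMetricSpace Y]
    {f g : X → Y} {s : Set X} (hf : LocallyLipschitzOn s f) (hfg : EqOn f g s) :
    LocallyLipschitzOn s g := by
  rw [locallyLipschitzOn_iff_restrict] at hf ⊢
  rwa [← domRestrict_eq_domRestrict_iff.2 hfg]

namespace IsReversiblePair

lemma fullGradient_eq (hφ : IsReversiblePair T P φf φb) (hP : IsLipschitzPressure T B L P) :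
    EqOn (fullGradient φf) (fullGradient φb) (reversibilitySet T φf φb) := fun p hp => by
  obtain ⟨hf, hb⟩ := hφ.hasFDerivAt hP hp
  rw [fullGradient_of_hasFDerivAt hf, fullGradient_of_hasFDerivAt hb]

lemma exists_norm_spaceGradient_le (hφ : IsReversiblePair T P φf φb)
    (hP : IsLipschitzPressure T B L P) (ha : 0 < a) (hT : 0 < T) :
    ∃ R : ℝ≥0, ∀ p ∈ reversibilitySet T φf φb, a ≤ p.2 → ‖spaceGradient φf p‖ ≤ R := by
  obtain ⟨R, hR⟩ := hφ.forward.exists_lipschitzWith hP ha hT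
  refine ⟨R, fun p hp hap => ?_⟩
  rw [← innerSL_apply_norm ℝ]
  exact (hasFDerivAt_slice (hφ.hasFDerivAt hP hp).1).le_of_lipschitz (hR p.2 ⟨hap, hp.1.2.le⟩)

lemma exists_quadratic_bounds (hφ : IsReversiblePair T P φf φb)
    (hP : IsLipschitzPressure T B L P) (hsc : IsSemiconcavePressure T P) (ha : 0 < a)
    (hb : b < T) :
    ∃ k, 0 ≤ k ∧ ∀ p ∈ reversibilitySet T φf φb, p.2 ∈ Icc a b → ∀ ξ,
      φf (p.1 + ξ, p.2) ≤ φf p + inner ℝ (spaceGradient φf p) ξ + k * ‖ξ‖ ^ 2 ∧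
      φf p + inner ℝ (spaceGradient φf p) ξ - k * ‖ξ‖ ^ 2 ≤ φb (p.1 + ξ, p.2) := by
  obtain ⟨kf, hkf⟩ := hφ.forward.exists_strongConcaveOn hP hsc ha hb
  obtain ⟨kb, hkb⟩ := hφ.backward.exists_strongConcaveOn_neg hP hsc ha hb
  refine ⟨max 0 (max (kf / 2) (kb / 2)), le_max_left _ _, fun p hp ht ξ => ?_⟩
  obtain ⟨hf, hb⟩ := hφ.hasFDerivAt hP hp
  have hup := le_of_strongConcaveOn_of_hasFDerivAt (hkf _ ht) (hasFDerivAt_slice hf) ξ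
  have hlow := le_of_strongConcaveOn_of_hasFDerivAt (hkb _ ht) (hasFDerivAt_slice hb).neg ξ
  rw [neg_apply] at hlow
  rw [innerSL_apply_apply] at hup hlow
  have hkf' : kf / 2 * ‖ξ‖ ^ 2 ≤ max 0 (max (kf / 2) (kb / 2)) * ‖ξ‖ ^ 2 := by
    gcongr
    exact (le_max_left _ _).trans (le_max_right _ _)
  have hkb' : kb / 2 * ‖ξ‖ ^ 2 ≤ max 0 (max (kf / 2) (kb / 2)) * ‖ξ‖ ^ 2 := by
    gcongr
    exact (le_max_right _ _).trans (le_max_right _ _)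
  have heq : φf (p.1, p.2) = φb (p.1, p.2) := hp.2
  change φf (p.1 + ξ, p.2) ≤ φf (p.1, p.2) + _ + _ ∧ φf (p.1, p.2) + _ - _ ≤ _
  constructor <;> linarith

/-- The expansions at `p`, propagated to the time of `p + z`, and the lower expansion at `p + z`
determine the two gradients up to an error of order `‖z‖`. -/
lemma exists_norm_spaceGradient_sub_le (hφ : IsReversiblePair T P φf φb)
    (hP : IsLipschitzPressure T B L P) (hsc : IsSemiconcavePressure T P) (ha : 0 < a)
    (hb : b < T) (hT : 0 < T) :
    ∃ N ρ, 0 ≤ N ∧ 0 < ρ ∧ ∀ p ∈ reversibilitySet T φf φb, p.2 ∈ Icc a b →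
      ∀ z, p + z ∈ reversibilitySet T φf φb → (p + z).2 ∈ Icc a b → 0 ≤ z.2 → z.2 ≤ ρ →
      ‖spaceGradient φf (p + z) - spaceGradient φf p‖ ≤ N * ‖z‖ := by
  obtain ⟨k, hk, hquad⟩ := hφ.exists_quadratic_bounds hP hsc ha hb
  obtain ⟨R, hR⟩ := hφ.exists_norm_spaceGradient_le hP ha hT
  set Kup : ℝ := k * (1 + R) ^ 2 + L * (1 + R)
  set Klow : ℝ := 2 * k * (1 + R) ^ 2 + L * (2 + R) + L ^ 2
  refine ⟨k + 4 * Kup + Klow, 1 / (4 * k + 2 * L + 1), by positivity, by positivity,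
    fun p hp hpt z hpz hpzt hz hzρ => ?_⟩
  rw [le_div_iff₀ (by positivity)] at hzρ
  set v := spaceGradient φf p
  set v' := spaceGradient φf (p + z)
  have hv : ‖v‖ ≤ R := hR p hp hpt.1
  have hle : ∀ q ∈ reversibilitySet T φf φb, ∀ ξ, φb (q.1 + ξ, q.2) ≤ φf (q.1 + ξ, q.2) :=
    fun q hq ξ => hφ.le (Ioo_subset_Icc_self hq.1)
  rcases eq_or_ne z 0 with rfl | hz0
  · simp [v, v']
  have hlow : φf p + hjCovector P p v z - Klow * ‖z‖ ^ 2 ≤ φf (p + z) :=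
    hφ.forward.add_hjCovector_le hP hp.1.1.le hz hpz.1.2.le hk hv hzρ fun ξ =>
      (hquad p hp hpt ξ).2.trans (hle p hp ξ)
  refine norm_le_of_forall_inner_le (norm_pos_iff.2 hz0) fun w hw => ?_
  have hup : φf (p + (z + (w, 0))) ≤
      φf p + hjCovector P p v (z + (w, 0)) + Kup * ‖z + (w, 0)‖ ^ 2 :=
    hφ.forward.le_add_hjCovector hP hp.1.1.le (by simpa using hz) (by simpa using hpz.1.2.le) hk
      hv fun ξ => (hquad p hp hpt ξ).1
  have hnorm : ‖z + (w, 0)‖ ≤ 2 * ‖z‖ := by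
    have hw0 : ‖((w, 0) : Space n × ℝ)‖ = ‖w‖ := by simp
    grw [norm_add_le, hw0, hw, two_mul]
  have hend : φf (p + z) + inner ℝ v' w - k * ‖w‖ ^ 2 ≤ φf (p + (z + (w, 0))) := by
    have hpzw : p + (z + (w, 0)) = ((p + z).1 + w, (p + z).2) := by
      rw [← add_assoc]
      exact Prod.ext rfl (add_zero _)
    rw [hpzw]
    exact (hquad _ hpz hpzt w).2.trans (hle _ hpz w)
  have hℓ : hjCovector P p v (w, 0) = inner ℝ v w := by simp
  rw [map_add, hℓ] at hup
  grw [hnorm] at hup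
  grw [hw] at hend
  rw [inner_sub_left]
  linarith

lemma exists_lipschitzOnWith_spaceGradient (hφ : IsReversiblePair T P φf φb)
    (hP : IsLipschitzPressure T B L P) (hsc : IsSemiconcavePressure T P) (ha : 0 < a)
    (hb : b < T) (hT : 0 < T) :
    ∃ K, LipschitzOnWith K (spaceGradient φf)
      (reversibilitySet T φf φb ∩ Prod.snd ⁻¹' Icc a b) := by
  obtain ⟨N, ρ, hN, hρ, hclose⟩ := hφ.exists_norm_spaceGradient_sub_le hP hsc ha hb hT
  obtain ⟨R, hR⟩ := hφ.exists_norm_spaceGradient_le hP ha hT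
  have hlater : ∀ p ∈ reversibilitySet T φf φb ∩ Prod.snd ⁻¹' Icc a b,
      ∀ q ∈ reversibilitySet T φf φb ∩ Prod.snd ⁻¹' Icc a b, p.2 ≤ q.2 →
      dist (spaceGradient φf q) (spaceGradient φf p) ≤ (N + 2 * R / ρ) * dist q p := by
    rintro p ⟨hp, hpt⟩ q ⟨hq, hqt⟩ hpq
    have hR0 : 0 ≤ 2 * R / ρ := by positivity
    rcases le_total (q.2 - p.2) ρ with hnear | hfar
    · have h := hclose p hp hpt (q - p) (by simpa using hq) (by simpa using hqt)
        (sub_nonneg.2 hpq) hnear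
      rw [add_sub_cancel, ← dist_eq_norm, ← dist_eq_norm] at h
      exact h.trans (by gcongr; exact le_add_of_nonneg_right hR0)
    · have hdist : ρ ≤ dist q p := hfar.trans ((le_abs_self _).trans (le_max_right _ _))
      calc dist (spaceGradient φf q) (spaceGradient φf p) ≤ R + R :=
            (dist_le_norm_add_norm _ _).trans (add_le_add (hR q hq hqt.1) (hR p hp hpt.1))
        _ = 2 * R / ρ * ρ := by field_simp; ring
        _ ≤ (N + 2 * R / ρ) * dist q p := by gcongr; exact le_add_of_nonneg_left hN
  refine ⟨.mk (N + 2 * R / ρ) (by positivity), LipschitzOnWith.of_dist_le_mul fun p hp q hq => ?_⟩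
  rw [NNReal.coe_mk]
  rcases le_total p.2 q.2 with hpq | hpq
  · rw [dist_comm, dist_comm p]
    exact hlater p hp q hq hpq
  · exact hlater q hq p hp hpq

lemma locallyLipschitzOn_spaceGradient (hφ : IsReversiblePair T P φf φb)
    (hP : IsLipschitzPressure T B L P) (hsc : IsSemiconcavePressure T P) :
    LocallyLipschitzOn (reversibilitySet T φf φb) (spaceGradient φf) := by
  intro p hp
  obtain ⟨a, ha, hap⟩ := exists_between hp.1.1
  obtain ⟨b, hpb, hb⟩ := exists_between hp.1.2
  obtain ⟨K, hK⟩ := hφ.exists_lipschitzOnWith_spaceGradient hP hsc ha hb (hp.1.1.trans hp.1.2)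
  exact ⟨K, _, inter_mem self_mem_nhdsWithin (mem_nhdsWithin_of_mem_nhds
    (continuous_snd.continuousAt.preimage_mem_nhds (Icc_mem_nhds hap hpb))), hK⟩

lemma locallyLipschitzOn_fullGradient (hφ : IsReversiblePair T P φf φb)
    (hP : IsLipschitzPressure T B L P) (hsc : IsSemiconcavePressure T P) :
    LocallyLipschitzOn (reversibilitySet T φf φb) (fullGradient φf) := by
  have hpressure : LocallyLipschitzOn (reversibilitySet T φf φb) P := by
    intro p _
    refine ⟨L, univ ×ˢ Icc 0 T, mem_of_superset self_mem_nhdsWithin fun q hq => ?_, hP.lipschitz⟩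
    exact ⟨mem_univ _, Ioo_subset_Icc_self hq.1⟩
  have hspace := hφ.locallyLipschitzOn_spaceGradient hP hsc
  have hhamiltonian : LocallyLipschitz fun q : Space n × ℝ => (q.1, q.2 - ‖q.1‖ ^ 2 / 2) :=
    (contDiff_fst.prodMk
      (contDiff_snd.sub ((contDiff_fst.norm_sq ℝ).div_const 2))).locallyLipschitz (𝕂 := ℝ)
  have heq : (reversibilitySet T φf φb).domRestrict (fullGradient φf) =
      (fun q : Space n × ℝ => (q.1, q.2 - ‖q.1‖ ^ 2 / 2)) ∘ fun p =>
        ((reversibilitySet T φf φb).domRestrict (spaceGradient φf) p,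
          (reversibilitySet T φf φb).domRestrict P p) :=
    funext fun p => fullGradient_of_hasFDerivAt (hφ.hasFDerivAt hP p.2).1
  rw [locallyLipschitzOn_iff_restrict] at hpressure hspace ⊢
  rw [heq]
  exact hhamiltonian.comp (hspace.prodMk hpressure)

end IsReversiblePair

end LocallyLipschitz

end HamiltonJacobi

end

theorem lemma4p9_general (n : ℕ) (T B : ℝ) (L : NNReal)
    (P : HamiltonJacobi.Space n × ℝ → ℝ)
    (hP : HamiltonJacobi.IsLipschitzPressure T B L P)
    (φf φb : HamiltonJacobi.Space n × ℝ → ℝ)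
    (hφ : HamiltonJacobi.IsReversiblePair T P φf φb) :
    (∀ p ∈ HamiltonJacobi.reversibilitySet T φf φb,
      DifferentiableAt ℝ φf p ∧ DifferentiableAt ℝ φb p ∧
      HamiltonJacobi.fullGradient φf p = HamiltonJacobi.fullGradient φb p ∧
      HamiltonJacobi.SatisfiesHJAt P φf p ∧ HamiltonJacobi.SatisfiesHJAt P φb p) ∧
    (HamiltonJacobi.IsSemiconcavePressure T P →
      LocallyLipschitzOn (HamiltonJacobi.reversibilitySet T φf φb)
        (HamiltonJacobi.fullGradient φf) ∧
      LocallyLipschitzOn (HamiltonJacobi.reversibilitySet T φf φb)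
        (HamiltonJacobi.fullGradient φb)) := by
  refine ⟨fun p hp => ?_, fun hsc => ?_⟩
  · obtain ⟨hf, hb⟩ := hφ.hasFDerivAt hP hp
    exact ⟨hf.differentiableAt, hb.differentiableAt, hφ.fullGradient_eq hP hp,
      HamiltonJacobi.satisfiesHJAt_of_hasFDerivAt hf,
      HamiltonJacobi.satisfiesHJAt_of_hasFDerivAt hb⟩
  · have hLip := hφ.locallyLipschitzOn_fullGradient hP hsc
    exact ⟨hLip, HamiltonJacobi.locallyLipschitzOn_congr hLip (hφ.fullGradient_eq hP)⟩

theorem lemma4p9 (n : ℕ) (T : ℝ) (hT : 0 < T)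
    (P : HamiltonJacobi.Space n × ℝ → ℝ)
    (hPper : HamiltonJacobi.IsTorusFunction T P)
    (hP : ContDiffOn ℝ 1 P (Set.univ ×ˢ Set.Icc (0 : ℝ) T))
    (φf φb : HamiltonJacobi.Space n × ℝ → ℝ)
    (hφ : HamiltonJacobi.IsReversiblePair T P φf φb) :
    (∀ p ∈ HamiltonJacobi.reversibilitySet T φf φb,
      DifferentiableAt ℝ φf p ∧ DifferentiableAt ℝ φb p ∧
      HamiltonJacobi.fullGradient φf p = HamiltonJacobi.fullGradient φb p ∧
      HamiltonJacobi.SatisfiesHJAt P φf p ∧ HamiltonJacobi.SatisfiesHJAt P φb p) ∧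
    (HamiltonJacobi.IsSemiconcavePressure T P →
      LocallyLipschitzOn (HamiltonJacobi.reversibilitySet T φf φb)
        (HamiltonJacobi.fullGradient φf) ∧
      LocallyLipschitzOn (HamiltonJacobi.reversibilitySet T φf φb)
        (HamiltonJacobi.fullGradient φb)) := by
  obtain ⟨B, L, hBL⟩ := HamiltonJacobi.exists_isLipschitzPressure hPper hP
  exact lemma4p9_general n T B L P hBL φf φb hφ
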